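/- Let $(\Omega,\mathcal F,\mathbb Q)$ be a probability space, $m>0$, $T>0$, and let $X_T>0$ be an integrable random variable with probability density $p$ on $(0,\infty)$. Let $\{\gamma_{tT}\}_{0\le t\le T}$ be a standard gamma bridge with parameter $m$, independent of $X_T$; that is, a process with the law of $\{\gamma_t/\gamma_T\}_{0\le t\le T}$, where $\{\gamma_t\}_{t\ge0}$ has independent increments, $\gamma_0=0$, and $\gamma_t$ has density $x^{mt-1}e^{-x}/\Gamma[mt]$ on $x>0$ for $t>0$. Put $\xi_t=X_T\gamma_{tT}$. Let $P_{uv}>0$ $(u\le v)$ be deterministic discount factors, and let $\mathrm B[a,b]=\Gamma[a]\Gamma[b]/\Gamma[a+b]$. Fix $0\le s<t<T$. (i) Define the price process of the Arrow–Debreu securities paying $\delta(\xi_t-y)$ at $t$ by $A_{st}(y)=P_{st}\,\mathbb E[\delta(\xi_t-y)\,|\,\xi_s]$, i.e. $y\mapsto A_{st}(y)/P_{st}$ is a density of the regular conditional law of $\xi_t$ given $\xi_s$. Then, almost surely, $$A_{st}(y)=P_{st}\,\frac{\mathbf 1_{\{y>\xi_s\}}(y-\xi_s)^{m(t-s)-1}}{\mathrm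 B[m(t-s),m(T-t)]}\;\frac{\int_y^\infty p(x)\,x^{1-mT}(x-y)^{m(T-t)-1}\,dx}{\int_{\xi_s}^\infty p(x)\,x^{1-mT}(x-\xi_s)^{m(T-s)-1}\,dx}$$ (as densities in $y$, i.e. up to Lebesgue-null sets of $y$). (ii) For $y\ge0$ put $$S(t,y)=P_{tT}\,\frac{\int_y^\infty p(x)\,x^{2-mT}(x-y)^{m(T-t)-1}\,dx}{\int_y^\infty p(x)\,x^{1-mT}(x-y)^{m(T-t)-1}\,dx},$$ and let $D_t$ be the set of $y\ge0$ for which the denominator is finite and positive. For $K\in\mathbb R$ the payoff $(S(t,\xi_t)-K)^+$ is integrable, and the option price $C_{st}=P_{st}\,\mathbb E[(S(t,\xi_t)-K)^+\,|\,\xi_s]$ satisfies, almost surely, $$C_{st}=\int_0^\infty A_{st}(y)\,(S(t,y)-K)^+\,dy .$$ (iii) Put $F(y)=\int_y^\infty p(x)(xP_{tT}-K)\,x^{1-mT}(x-y)^{m(T-t)-1}\,dx$, let $y^*\in D_t$ be a critical value, $F(y^*)=0$, and suppose that $S(t,\cdot)$ is non-decreasing on $D_t$ or, more generally, that $y^*$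 is the only crossing value: for $y\in D_t$, $F(y)\le 0$ if $y<y^*$ and $F(y)\ge0$ if $y>y^*$. Then, almost surely, $$C_{st}=P_{st}\int_{y^*}^\infty \pi_s(x)\,(xP_{tT}-K)\,\mathcal B\!\left(\frac{y^*-\xi_s}{x-\xi_s}\right)dx,$$ where $$\pi_s(x)=\mathbf 1_{\{x>\xi_s\}}\frac{p(x)\,x^{1-mT}(x-\xi_s)^{m(T-s)-1}}{\int_{\xi_s}^\infty p(z)\,z^{1-mT}(z-\xi_s)^{m(T-s)-1}\,dz}$$ and $\mathcal B(u)=\int_{\max(u,0)}^1 z^{m(t-s)-1}(1-z)^{m(T-t)-1}\,dz\big/\int_0^1 z^{m(t-s)-1}(1-z)^{m(T-t)-1}\,dz$ for $u<1$ is the complementary beta distribution function with parameters $m(t-s)$ and $m(T-t)$ (and $\mathcal B(u)=0$ for $u\ge1$). -/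

import Mathlib

open MeasureTheory ProbabilityTheory Set
open scoped NNReal ENNReal

noncomputable section

/-- A standard gamma process with growth rate `m`: it starts at `0`, has independent increments,
and `γ t` has the gamma density `x ^ (m t - 1) e ^ (-x) / Γ(m t)` on `x > 0`, for every `t > 0`. -/
structure IsStandardGammaProcess {Ω : Type*} [MeasurableSpace Ω] (m : ℝ)
    (γ : ℝ≥0 → Ω → ℝ) (Q : Measure Ω) : Prop where
  measurable : ∀ t, Measurable (γ t)
  zero : ∀ᵐ ω ∂Q, γ 0 ω = 0
  indep_increments : HasIndepIncrements γ Q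
  law : ∀ t : ℝ≥0, 0 < t → Q.map (γ t) = gammaMeasure (m * t) 1

/-- A standard gamma bridge over `[0, T]` with parameter `m`: a process having the same law (on the
space of all functions `[0, T] → ℝ` with the product σ-algebra) as `γ t / γ T`, `0 ≤ t ≤ T`, for
some standard gamma process `γ` with growth rate `m`, possibly living on another probability
space. -/
structure IsGammaBridge {Ω : Type*} [MeasurableSpace Ω] (m : ℝ) (T : ℝ≥0)
    (β : Set.Iic T → Ω → ℝ) (Q : Measure Ω) : Prop where
  measurable : ∀ t, Measurable (β t)
  law : ∃ (Ω' : Type) (_ : MeasurableSpace Ω') (Q' : Measure Ω') (_ : IsProbabilityMeasure Q')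
    (γ : ℝ≥0 → Ω' → ℝ), IsStandardGammaProcess m γ Q' ∧
      Q.map (fun ω (t : Set.Iic T) ↦ β t ω) =
        Q'.map (fun ω' (t : Set.Iic T) ↦ γ t ω' / γ T ω')

/-- The aggregate claims process `ξ_t = X_T γ_{tT}`. -/
def claimsProcess {Ω : Type*} {T : ℝ≥0} (X : Ω → ℝ) (β : Set.Iic T → Ω → ℝ) :
    Set.Iic T → Ω → ℝ :=
  fun t ω ↦ X ω * β t ω

/-- The integrand `p(x) x ^ (1 - m T) (x - y) ^ (m (T - t) - 1)`. -/
def weight (m : ℝ) (T : ℝ≥0) (p : ℝ → ℝ) (t : ℝ≥0) (y x : ℝ) : ℝ :=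
  p x * x ^ (1 - m * T) * (x - y) ^ (m * ((T : ℝ) - t) - 1)

/-- `∫_y^∞ p(x) x ^ (1 - m T) (x - y) ^ (m (T - t) - 1) dx`. -/
def weightIntegral (m : ℝ) (T : ℝ≥0) (p : ℝ → ℝ) (t : ℝ≥0) (y : ℝ) : ℝ :=
  ∫ x in Ioi y, weight m T p t y x

/-- The conditional density `π_t(x)` of the terminal cash flow, as a function of the value `ξ` of
the claims process at time `t`. -/
def condDensity (m : ℝ) (T : ℝ≥0) (p : ℝ → ℝ) (t : ℝ≥0) (ξ x : ℝ) : ℝ :=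
  (Ioi ξ).indicator (fun x ↦ weight m T p t ξ x / weightIntegral m T p t ξ) x

/-- The reserve function `S(t, y)`, where `P u v` is the discount factor from `v` to `u`. -/
def reserve (m : ℝ) (T : ℝ≥0) (p : ℝ → ℝ) (P : ℝ≥0 → ℝ≥0 → ℝ) (t : ℝ≥0) (y : ℝ) : ℝ :=
  P t T * ((∫ x in Ioi y, p x * x ^ (2 - m * T) * (x - y) ^ (m * ((T : ℝ) - t) - 1)) /
    weightIntegral m T p t y)

/-- The set of `y ≥ 0` at which the quotient defining `S(t, y)` makes sense: its denominator is
finite and positive. -/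
def reserveDomain (m : ℝ) (T : ℝ≥0) (p : ℝ → ℝ) (t : ℝ≥0) : Set ℝ :=
  {y | 0 ≤ y ∧ IntegrableOn (weight m T p t y) (Ioi y) ∧ 0 < weightIntegral m T p t y}

/-- The integral `∫_y^∞ p(x) (x P_{tT} - K) x ^ (1 - m T) (x - y) ^ (m (T - t) - 1) dx`, whose
zeros are the critical values. -/
def criticalIntegral (m : ℝ) (T : ℝ≥0) (p : ℝ → ℝ) (P : ℝ≥0 → ℝ≥0 → ℝ) (t : ℝ≥0)
    (K y : ℝ) : ℝ :=
  ∫ x in Ioi y, p x * (x * P t T - K) * x ^ (1 - m * T) * (x - y) ^ (m * ((T : ℝ) - t) - 1)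

/-- `y` is a critical value. -/
def IsCriticalValue (m : ℝ) (T : ℝ≥0) (p : ℝ → ℝ) (P : ℝ≥0 → ℝ≥0 → ℝ) (t : ℝ≥0)
    (K y : ℝ) : Prop :=
  y ∈ reserveDomain m T p t ∧ criticalIntegral m T p P t K y = 0

/-- `y` is the only value at which the critical integral passes from non-positive to
non-negative. -/
def IsSingleCrossing (m : ℝ) (T : ℝ≥0) (p : ℝ → ℝ) (P : ℝ≥0 → ℝ≥0 → ℝ) (t : ℝ≥0)
    (K ystar : ℝ) : Prop :=
  ∀ y ∈ reserveDomain m T p t,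
    (y < ystar → criticalIntegral m T p P t K y ≤ 0) ∧
    (ystar < y → 0 ≤ criticalIntegral m T p P t K y)

/-- The complementary beta distribution function with parameters `a` and `b`; it equals `1` for
`u ≤ 0` and `0` for `u ≥ 1`. -/
def complBeta (a b u : ℝ) : ℝ :=
  (∫ z in Ioo (max u 0) 1, z ^ (a - 1) * (1 - z) ^ (b - 1)) /
    ∫ z in Ioo (0 : ℝ) 1, z ^ (a - 1) * (1 - z) ^ (b - 1)

/-- `y ↦ A y` is the price `P_{st} E[δ(ξ_t - y) | ξ_s]` of the Arrow–Debreu securities: as usual,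
the conditional expectation of the Dirac distribution is the density at `y` of the regular
conditional law of `ξ_t` given `ξ_s`. The family is `σ(ξ_s)`-measurable, jointly with `y`. -/
structure IsArrowDebreuPrice {Ω : Type*} [MeasurableSpace Ω] (Q : Measure Ω) [IsFiniteMeasure Q]
    (ξs ξt : Ω → ℝ) (Pst : ℝ) (A : ℝ → Ω → ℝ) : Prop where
  measurable : @Measurable (ℝ × Ω) ℝ
    (MeasurableSpace.prod inferInstance (MeasurableSpace.comap ξs inferInstance)) inferInstance
    (Function.uncurry A)
  nonneg : ∀ᵐ ω ∂Q, ∀ y, 0 ≤ A y ω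
  density : ∀ᵐ ω ∂Q, ENNReal.ofReal Pst • condDistrib ξt ξs Q (ξs ω) =
    (volume : Measure ℝ).withDensity (fun y ↦ ENNReal.ofReal (A y ω))

/-- The explicit Arrow–Debreu price at `y`, as a function of the value `ξ` of the claims process at
time `s`. The function `beta` is the Euler beta function. -/
def arrowDebreu (m : ℝ) (T : ℝ≥0) (p : ℝ → ℝ) (P : ℝ≥0 → ℝ≥0 → ℝ) (s t : ℝ≥0) (ξ y : ℝ) : ℝ :=
  P s t *
    ((Ioi ξ).indicator (fun y ↦ (y - ξ) ^ (m * ((t : ℝ) - s) - 1)) y /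
      beta (m * ((t : ℝ) - s)) (m * ((T : ℝ) - t))) *
    (weightIntegral m T p t y / weightIntegral m T p s ξ)

/-- The price `C_{st} = P_{st} E[(S(t, ξ_t) - K)⁺ | ξ_s]` at time `s` of the call option with
strike `K` and maturity `t` on the reserve. -/
def optionPrice {Ω : Type*} [MeasurableSpace Ω] (Q : Measure Ω) (m : ℝ) (T : ℝ≥0) (p : ℝ → ℝ)
    (P : ℝ≥0 → ℝ≥0 → ℝ) (ξ : Set.Iic T → Ω → ℝ) (s t : Set.Iic T) (K : ℝ) : Ω → ℝ :=
  fun ω ↦ P s t *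
    (Q[fun ω' ↦ max (reserve m T p P t (ξ t ω') - K) 0 |
      MeasurableSpace.comap (ξ s) inferInstance]) ω

end

theorem lintegral_eq_mul_lintegral_comp_add_mul (F : ℝ → ℝ≥0∞) (hF : Measurable F) (c : ℝ) {w : ℝ}
    (hw : 0 < w) : ∫⁻ y, F y = ENNReal.ofReal w * ∫⁻ z, F (c + w * z) := by
  have h1 : ∫⁻ y, F (c + y) = ENNReal.ofReal w * ∫⁻ z, F (c + w * z) := by
    conv_lhs => rw [← Real.smul_map_volume_mul_left hw.ne']
    rw [lintegral_smul_measure, lintegral_map (by fun_prop) (by fun_prop), abs_of_pos hw]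
    rfl
  rw [← h1, lintegral_add_left_eq_self F c]

@[fun_prop]
theorem measurable_gammaPDF (a r : ℝ) : Measurable (gammaPDF a r) :=
  (measurable_gammaPDFReal a r).ennreal_ofReal

@[fun_prop]
theorem measurable_betaPDF (a b : ℝ) : Measurable (betaPDF a b) :=
  (measurable_betaPDFReal a b).ennreal_ofReal

theorem mul_gammaPDF_mul_gammaPDF {a b w z : ℝ} (ha : 0 < a) (hb : 0 < b) (hw : 0 < w)
    (hz0 : z ≠ 0) (hz1 : z ≠ 1) :
    ENNReal.ofReal w * (gammaPDF a 1 (w * z) * gammaPDF b 1 (w - w * z)) =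
      betaPDF a b z * gammaPDF (a + b) 1 w := by
  rcases lt_or_gt_of_ne hz0 with hz | hz
  · rw [gammaPDF_of_neg (mul_neg_of_pos_of_neg hw hz), betaPDF_eq_zero_of_nonpos hz.le]
    simp
  rcases lt_or_gt_of_ne hz1 with hz' | hz'
  · have hw' : 0 < w - w * z := by nlinarith
    have h1z : 0 < 1 - z := by linarith
    rw [gammaPDF_of_nonneg (by positivity), gammaPDF_of_nonneg hw'.le, gammaPDF_of_nonneg hw.le,
      betaPDF_of_pos_lt_one hz hz']
    have hΓa := Real.Gamma_pos_of_pos ha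
    have hΓb := Real.Gamma_pos_of_pos hb
    have hΓab := Real.Gamma_pos_of_pos (add_pos ha hb)
    have hβ := beta_pos ha hb
    rw [← ENNReal.ofReal_mul (by positivity), ← ENNReal.ofReal_mul (by positivity),
      ← ENNReal.ofReal_mul (by positivity)]
    congr 1
    have e1 : w - w * z = w * (1 - z) := by ring
    rw [e1, Real.mul_rpow hw.le hz.le, Real.mul_rpow hw.le h1z.le, beta]
    have e2 : w ^ (a + b - 1) = w * w ^ (a - 1) * w ^ (b - 1) := by
      rw [show a + b - 1 = 1 + (a - 1) + (b - 1) by ring, Real.rpow_add hw, Real.rpow_add hw,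
        Real.rpow_one]
    have e3 : Real.exp (-(1 * w)) =
        Real.exp (-(1 * (w * z))) * Real.exp (-(1 * (w * (1 - z)))) := by
      rw [← Real.exp_add]; congr 1; ring
    rw [e2, e3]
    simp only [Real.one_rpow]
    field_simp
  · rw [gammaPDF_of_neg (x := w - w * z) (by nlinarith), betaPDF_eq_zero_of_one_le hz'.le]
    simp

/-- The beta-gamma algebra: for independent gamma variables `U`, `V` the ratio `U / (U + V)` is beta
distributed and independent of `U + V`, which is gamma distributed. -/
theorem map_gammaMeasure_prod_gammaMeasure {a b : ℝ} (ha : 0 < a) (hb : 0 < b) :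
    ((gammaMeasure a 1).prod (gammaMeasure b 1)).map (fun q ↦ (q.1 / (q.1 + q.2), q.1 + q.2)) =
      (betaMeasure a b).prod (gammaMeasure (a + b) 1) := by
  have := isProbabilityMeasure_gammaMeasure ha one_pos
  have := isProbabilityMeasure_gammaMeasure hb one_pos
  have := isProbabilityMeasure_gammaMeasure (add_pos ha hb) one_pos
  have := isProbabilityMeasureBeta ha hb
  refine Measure.ext_of_lintegral _ fun f hf ↦ ?_
  rw [lintegral_map hf (by fun_prop), lintegral_prod _ (by fun_prop),
    lintegral_prod_symm _ (by fun_prop)]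
  have hL : ∀ u : ℝ, ∫⁻ v, f (u / (u + v), u + v) ∂gammaMeasure b 1 =
      ∫⁻ w, gammaPDF b 1 (w - u) * f (u / w, w) := by
    intro u
    rw [gammaMeasure, lintegral_withDensity_eq_lintegral_mul _ (by fun_prop) (by fun_prop),
      ← lintegral_add_left_eq_self (fun w ↦ gammaPDF b 1 (w - u) * f (u / w, w)) u]
    simp
  simp_rw [hL]
  have hR : ∀ w : ℝ, ∫⁻ z, f (z, w) ∂betaMeasure a b = ∫⁻ z, betaPDF a b z * f (z, w) := by
    intro w
    rw [betaMeasure, lintegral_withDensity_eq_lintegral_mul _ (by fun_prop) (by fun_prop)]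
    simp
  simp_rw [hR]
  rw [gammaMeasure, gammaMeasure,
    lintegral_withDensity_eq_lintegral_mul _ (by fun_prop) (by fun_prop),
    lintegral_withDensity_eq_lintegral_mul _ (by fun_prop) (by fun_prop)]
  simp only [Pi.mul_apply]
  have hL2 : ∀ u, gammaPDF a 1 u * ∫⁻ w, gammaPDF b 1 (w - u) * f (u / w, w) =
      ∫⁻ w, gammaPDF a 1 u * (gammaPDF b 1 (w - u) * f (u / w, w)) := fun u ↦
    (lintegral_const_mul _ (by fun_prop)).symm
  simp_rw [hL2]
  rw [lintegral_lintegral_swap (by fun_prop)]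
  refine lintegral_congr_ae ?_
  filter_upwards [Measure.ae_ne volume (0 : ℝ)] with w hw0
  rcases lt_or_gt_of_ne hw0 with hw | hw
  · rw [gammaPDF_of_neg hw, zero_mul]
    refine (lintegral_congr fun u ↦ ?_).trans lintegral_zero
    rcases lt_or_ge u 0 with hu | hu
    · rw [gammaPDF_of_neg hu, zero_mul]
    · rw [gammaPDF_of_neg (x := w - u) (by linarith), zero_mul, mul_zero]
  · rw [lintegral_eq_mul_lintegral_comp_add_mul _ (by fun_prop) 0 hw,
      ← lintegral_const_mul _ (by fun_prop), ← lintegral_const_mul _ (by fun_prop)]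
    refine lintegral_congr_ae ?_
    filter_upwards [Measure.ae_ne volume (0 : ℝ), Measure.ae_ne volume (1 : ℝ)] with z hz0 hz1
    have := mul_gammaPDF_mul_gammaPDF ha hb hw hz0 hz1
    rw [zero_add, mul_div_cancel_left₀ _ hw0, ← mul_assoc (gammaPDF a 1 _), ← mul_assoc, this]
    ring

theorem gammaMeasure_conv_gammaMeasure {a b : ℝ} (ha : 0 < a) (hb : 0 < b) :
    (gammaMeasure a 1) ∗ (gammaMeasure b 1) = gammaMeasure (a + b) 1 := by
  have := isProbabilityMeasure_gammaMeasure ha one_pos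
  have := isProbabilityMeasure_gammaMeasure hb one_pos
  have := isProbabilityMeasure_gammaMeasure (add_pos ha hb) one_pos
  have := isProbabilityMeasureBeta ha hb
  have h := congrArg (fun μ ↦ μ.map Prod.snd) (map_gammaMeasure_prod_gammaMeasure ha hb)
  beta_reduce at h
  rw [Measure.map_map (by fun_prop) (by fun_prop), Measure.map_snd_prod] at h
  simpa [Measure.conv, Function.comp_def] using h

theorem lintegral_gammaMeasure_ofReal {a : ℝ} (ha : 0 < a) :
    ∫⁻ x, ENNReal.ofReal |x| ∂gammaMeasure a 1 = ENNReal.ofReal a := by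
  rw [gammaMeasure, lintegral_withDensity_eq_lintegral_mul _ (by fun_prop) (by fun_prop)]
  have : ∀ᵐ x : ℝ, (gammaPDF a 1 * fun x ↦ ENNReal.ofReal |x|) x =
      ENNReal.ofReal a * gammaPDF (a + 1) 1 x := by
    filter_upwards [Measure.ae_ne volume (0 : ℝ)] with x hx0
    rcases lt_or_gt_of_ne hx0 with hx | hx
    · simp [gammaPDF_of_neg hx]
    · have hΓ := Real.Gamma_pos_of_pos ha
      have hΓ' := Real.Gamma_pos_of_pos (add_pos ha one_pos)
      rw [Pi.mul_apply, gammaPDF_of_nonneg hx.le, gammaPDF_of_nonneg hx.le,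
        ← ENNReal.ofReal_mul (by positivity), ← ENNReal.ofReal_mul ha.le, abs_of_pos hx,
        Real.Gamma_add_one ha.ne', add_sub_cancel_right]
      congr 1
      have e : x ^ a = x ^ (a - 1) * x := by
        rw [← Real.rpow_add_one hx0, sub_add_cancel]
      rw [e, Real.one_rpow, Real.one_rpow]
      field_simp
  rw [lintegral_congr_ae this, lintegral_const_mul _ (by fun_prop),
    lintegral_gammaPDF_eq_one (by linarith) one_pos, mul_one]

theorem norm_one_sub_charFun_gammaMeasure_le {a : ℝ} (ha : 0 < a) (t : ℝ) :
    ‖1 - charFun (gammaMeasure a 1) t‖ ≤ |t| * a := by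
  have := isProbabilityMeasure_gammaMeasure ha one_pos
  have hI : Integrable (fun x : ℝ ↦ |x|) (gammaMeasure a 1) := by
    refine ⟨by fun_prop, ?_⟩
    rw [hasFiniteIntegral_iff_ofReal (by filter_upwards with x; positivity),
      lintegral_gammaMeasure_ofReal ha]
    exact ENNReal.ofReal_lt_top
  have hm : ∫ x, |x| ∂gammaMeasure a 1 = a := by
    rw [integral_eq_lintegral_of_nonneg_ae (by filter_upwards with x; positivity) (by fun_prop),
      lintegral_gammaMeasure_ofReal ha, ENNReal.toReal_ofReal ha.le]
  have hexp : Integrable (fun x : ℝ ↦ Complex.exp (t * x * Complex.I)) (gammaMeasure a 1) := by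
    refine Integrable.of_bound (by fun_prop) 1 ?_
    filter_upwards with x
    rw [← Complex.ofReal_mul, Complex.norm_exp_ofReal_mul_I]
  have h1 : 1 - charFun (gammaMeasure a 1) t =
      ∫ x : ℝ, (1 - Complex.exp (t * x * Complex.I)) ∂gammaMeasure a 1 := by
    rw [integral_sub (integrable_const _) hexp, charFun_apply_real]
    simp
  rw [h1]
  calc _ ≤ ∫ x : ℝ, |t| * |x| ∂gammaMeasure a 1 := by
        refine norm_integral_le_of_norm_le (hI.const_mul _) ?_
        filter_upwards with x
        rw [norm_sub_rev, ← Complex.ofReal_mul, mul_comm, ← abs_mul]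
        exact Real.norm_exp_I_mul_ofReal_sub_one_le
    _ = |t| * a := by rw [integral_const_mul, hm]

theorem charFun_gammaMeasure_ne_zero {a : ℝ} (ha : 0 < a) (t : ℝ) :
    charFun (gammaMeasure a 1) t ≠ 0 := by
  intro h0
  have hn : ∀ n : ℕ, charFun (gammaMeasure (a / 2 ^ n) 1) t = 0 := by
    intro n
    induction n with
    | zero => simpa using h0
    | succ n ih =>
      have hpos : 0 < a / 2 ^ (n + 1) := by positivity
      have := isProbabilityMeasure_gammaMeasure hpos one_pos
      have hc := gammaMeasure_conv_gammaMeasure hpos hpos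
      rw [show a / 2 ^ (n + 1) + a / 2 ^ (n + 1) = a / 2 ^ n by
        rw [pow_succ]; field_simp; norm_num] at hc
      rw [← hc, charFun_conv] at ih
      exact mul_self_eq_zero.1 ih
  have hlim : Filter.Tendsto (fun n : ℕ ↦ |t| * (a / 2 ^ n)) Filter.atTop (nhds (|t| * 0)) := by
    refine Filter.Tendsto.const_mul _ ?_
    exact tendsto_const_nhds.div_atTop (tendsto_pow_atTop_atTop_of_one_lt one_lt_two)
  have : (1 : ℝ) ≤ |t| * 0 := by
    refine ge_of_tendsto' hlim fun n ↦ ?_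
    have := norm_one_sub_charFun_gammaMeasure_le (a := a / 2 ^ n) (by positivity) t
    simpa [hn n] using this
  norm_num at this

theorem eq_gammaMeasure_of_conv_eq {a b : ℝ} (ha : 0 < a) (hb : 0 < b) {μ : Measure ℝ}
    [IsProbabilityMeasure μ] (h : (gammaMeasure a 1) ∗ μ = gammaMeasure (a + b) 1) :
    μ = gammaMeasure b 1 := by
  have := isProbabilityMeasure_gammaMeasure ha one_pos
  have := isProbabilityMeasure_gammaMeasure hb one_pos
  refine Measure.ext_of_charFun (funext fun t ↦ ?_)
  have h1 := congrArg (fun ν ↦ charFun ν t) h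
  beta_reduce at h1
  rw [← gammaMeasure_conv_gammaMeasure ha hb, charFun_conv, charFun_conv] at h1
  exact mul_left_cancel₀ (charFun_gammaMeasure_ne_zero ha t) h1

namespace IsStandardGammaProcess

variable {Ω : Type*} [MeasurableSpace Ω] {m : ℝ} {γ : ℝ≥0 → Ω → ℝ} {Q : Measure Ω}
  [IsProbabilityMeasure Q]

theorem map_increment (hγ : IsStandardGammaProcess m γ Q) (hm : 0 < m) {r t : ℝ≥0} (hrt : r < t) :
    Q.map (fun ω ↦ γ t ω - γ r ω) = gammaMeasure (m * ((t : ℝ) - r)) 1 := by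
  have hrt' : (r : ℝ) < t := hrt
  have hγm := hγ.measurable
  rcases eq_or_lt_of_le (zero_le : 0 ≤ r) with rfl | hr
  · rw [NNReal.coe_zero, sub_zero, ← hγ.law t hrt]
    refine Measure.map_congr ?_
    filter_upwards [hγ.zero] with ω hω using by simp [hω]
  · have := Measure.isProbabilityMeasure_map (μ := Q) (f := fun ω ↦ γ t ω - γ r ω)
      (by fun_prop)
    have hr' : (0 : ℝ) < r := hr
    refine eq_gammaMeasure_of_conv_eq (a := m * r) (by positivity)
      (mul_pos hm (sub_pos.2 hrt')) ?_
    have hind : IndepFun (γ r) (γ t - γ r) Q :=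
      hγ.indep_increments.indepFun_eval_sub (zero_le : 0 ≤ r) hrt.le hγ.zero
    have h := hind.map_add_eq_map_conv_map (by fun_prop) (by fun_prop)
    rw [add_sub_cancel, hγ.law t (hr.trans hrt), hγ.law r hr] at h
    rw [show m * r + m * ((t : ℝ) - r) = m * t by ring, h]
    rfl

theorem ae_ne_of_lt (hγ : IsStandardGammaProcess m γ Q) (hm : 0 < m) {r t : ℝ≥0} (hrt : r < t) :
    ∀ᵐ ω ∂Q, γ t ω - γ r ω ≠ 0 := by
  have hγm := hγ.measurable
  have h : ∀ᵐ x ∂(Q.map (fun ω ↦ γ t ω - γ r ω)), x ≠ 0 := by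
    rw [hγ.map_increment hm hrt, gammaMeasure]
    exact withDensity_absolutelyContinuous _ _ |>.ae_le (Measure.ae_ne volume (0 : ℝ))
  exact ae_of_ae_map (p := fun x : ℝ ↦ x ≠ 0) (by fun_prop) h

theorem map_ratio (hγ : IsStandardGammaProcess m γ Q) (hm : 0 < m) {s T : ℝ≥0} (hs : 0 < s)
    (hsT : s < T) :
    Q.map (fun ω ↦ γ s ω / γ T ω) = betaMeasure (m * s) (m * ((T : ℝ) - s)) := by
  have hγm := hγ.measurable
  have hs' : (0 : ℝ) < s := hs
  have hsT' : (s : ℝ) < T := hsT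
  have ha : 0 < m * s := by positivity
  have hb : 0 < m * ((T : ℝ) - s) := mul_pos hm (sub_pos.2 hsT')
  have := isProbabilityMeasure_gammaMeasure (add_pos ha hb) one_pos
  have hind : IndepFun (γ s) (fun ω ↦ γ T ω - γ s ω) Q :=
    hγ.indep_increments.indepFun_eval_sub (zero_le : 0 ≤ s) hsT.le hγ.zero
  have hlaw := (indepFun_iff_map_prod_eq_prod_map_map (by fun_prop) (by fun_prop)).1 hind
  rw [hγ.law s hs, hγ.map_increment hm hsT] at hlaw
  have h := congrArg (fun μ ↦ μ.map Prod.fst) (map_gammaMeasure_prod_gammaMeasure ha hb)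
  beta_reduce at h
  rw [← hlaw, Measure.map_map (by fun_prop) (by fun_prop), Measure.map_map (by fun_prop)
    (by fun_prop), Measure.map_fst_prod] at h
  simpa [Function.comp_def] using h

theorem map_ratio_pair (hγ : IsStandardGammaProcess m γ Q) (hm : 0 < m) {s t T : ℝ≥0}
    (hst : s < t) (htT : t < T) :
    Q.map (fun ω ↦ (γ s ω / γ T ω, γ t ω / γ T ω)) =
      ((Q.map (fun ω ↦ γ s ω / γ T ω)).prod
        (betaMeasure (m * ((t : ℝ) - s)) (m * ((T : ℝ) - t)))).map
          (fun q ↦ (q.1, q.1 + (1 - q.1) * q.2)) := by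
  have hγm := hγ.measurable
  have hst' : (s : ℝ) < t := hst
  have htT' : (t : ℝ) < T := htT
  set a := m * ((t : ℝ) - s) with ha_def
  set b := m * ((T : ℝ) - t) with hb_def
  have ha : 0 < a := mul_pos hm (sub_pos.2 hst')
  have hb : 0 < b := mul_pos hm (sub_pos.2 htT')
  have := isProbabilityMeasure_gammaMeasure ha one_pos
  have := isProbabilityMeasure_gammaMeasure hb one_pos
  have := isProbabilityMeasure_gammaMeasure (add_pos ha hb) one_pos
  have := isProbabilityMeasureBeta ha hb
  let G : Ω → ℝ := fun ω ↦ γ s ω - γ 0 ω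
  have hGm : Measurable G := by fun_prop
  have hind : IndepFun G (fun ω ↦ (γ t ω - γ s ω, γ T ω - γ t ω)) Q := by
    let τ : ℕ → ℝ≥0
      | 0 => 0
      | 1 => s
      | 2 => t
      | _ => T
    have hτ : Monotone τ := by
      refine monotone_nat_of_le_succ fun n ↦ ?_
      match n with
      | 0 => exact zero_le
      | 1 => exact hst.le
      | 2 => exact htT.le
      | n + 3 => exact le_rfl
    have h := hγ.indep_increments.nat hτ
    exact (h.indepFun_prodMk (fun i ↦ by fun_prop) 1 2 0 (by norm_num) (by norm_num)).symm
  have hind2 : IndepFun (fun ω ↦ γ t ω - γ s ω) (fun ω ↦ γ T ω - γ t ω) Q :=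
    hγ.indep_increments.indepFun_sub_sub hst.le htT.le
  have hlaw2 := (indepFun_iff_map_prod_eq_prod_map_map (by fun_prop) (by fun_prop)).1 hind2
  rw [hγ.map_increment hm hst, hγ.map_increment hm htT] at hlaw2
  have hlaw3 : Q.map (fun ω ↦ ((γ t ω - γ s ω) / (γ T ω - γ s ω), γ T ω - γ s ω)) =
      (betaMeasure a b).prod (gammaMeasure (a + b) 1) := by
    rw [← map_gammaMeasure_prod_gammaMeasure ha hb, ← hlaw2,
      Measure.map_map (by fun_prop) (by fun_prop)]
    congr 1
    ext ω : 1
    simp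
  have hind' : IndepFun G (fun ω ↦ ((γ t ω - γ s ω) / (γ T ω - γ s ω), γ T ω - γ s ω)) Q := by
    have h := hind.comp (φ := id) (ψ := fun q : ℝ × ℝ ↦ (q.1 / (q.1 + q.2), q.1 + q.2))
      measurable_id (by fun_prop)
    convert! h using 2
    simp
  have hlaw := (indepFun_iff_map_prod_eq_prod_map_map (by fun_prop) (by fun_prop)).1 hind'
  rw [hlaw3] at hlaw
  have hT0 : ∀ᵐ ω ∂Q, γ T ω ≠ 0 := by
    filter_upwards [hγ.ae_ne_of_lt hm ((zero_le : 0 ≤ t).trans_lt htT), hγ.zero] with ω h1 h2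
    simpa [h2] using h1
  have hZ : ∀ᵐ ω ∂Q, γ s ω / γ T ω = G ω / (G ω + (γ T ω - γ s ω)) := by
    filter_upwards [hγ.zero] with ω h
    simp [G, h]
  have hZt : ∀ᵐ ω ∂Q, γ t ω / γ T ω = G ω / (G ω + (γ T ω - γ s ω)) +
      (1 - G ω / (G ω + (γ T ω - γ s ω))) * ((γ t ω - γ s ω) / (γ T ω - γ s ω)) := by
    filter_upwards [hγ.zero, hT0, hγ.ae_ne_of_lt hm (hst.trans htT)] with ω h h1 h2
    simp only [G, h, sub_zero, add_sub_cancel]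
    field_simp
    ring
  have := Measure.isProbabilityMeasure_map (μ := Q) hGm.aemeasurable
  refine Measure.ext_of_lintegral _ fun f hf ↦ ?_
  rw [lintegral_map hf (by fun_prop), lintegral_map hf (by fun_prop),
    lintegral_prod _ (by fun_prop), lintegral_map (by fun_prop) (by fun_prop)]
  have hL : ∫⁻ ω, f (γ s ω / γ T ω, γ t ω / γ T ω) ∂Q =
      ∫⁻ q : ℝ × ℝ × ℝ, f (q.1 / (q.1 + q.2.2), q.1 / (q.1 + q.2.2) +
        (1 - q.1 / (q.1 + q.2.2)) * q.2.1) ∂((Q.map G).prod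
          ((betaMeasure a b).prod (gammaMeasure (a + b) 1))) := by
    rw [← hlaw, lintegral_map (by fun_prop) (by fun_prop)]
    refine lintegral_congr_ae ?_
    filter_upwards [hZ, hZt] with ω h1 h2
    rw [h1, h2]
  have hR : ∫⁻ ω, ∫⁻ v, f (γ s ω / γ T ω, γ s ω / γ T ω + (1 - γ s ω / γ T ω) * v)
        ∂betaMeasure a b ∂Q =
      ∫⁻ q : ℝ × ℝ × ℝ, ∫⁻ v, f (q.1 / (q.1 + q.2.2), q.1 / (q.1 + q.2.2) +
        (1 - q.1 / (q.1 + q.2.2)) * v) ∂betaMeasure a b ∂((Q.map G).prod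
          ((betaMeasure a b).prod (gammaMeasure (a + b) 1))) := by
    rw [← hlaw, lintegral_map (by fun_prop) (by fun_prop)]
    refine lintegral_congr_ae ?_
    filter_upwards [hZ] with ω h1
    rw [h1]
  rw [hL, hR, lintegral_prod _ (by fun_prop), lintegral_prod _ (by fun_prop)]
  refine lintegral_congr fun g ↦ ?_
  rw [lintegral_prod_symm _ (by fun_prop), lintegral_prod_symm _ (by fun_prop)]
  simp

end IsStandardGammaProcess

namespace IsGammaBridge

variable {Ω : Type*} [MeasurableSpace Ω] {m : ℝ} {T : ℝ≥0} {β : Set.Iic T → Ω → ℝ} {Q : Measure Ω}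

theorem map_eval (hβ : IsGammaBridge m T β Q) (hm : 0 < m) {s : Set.Iic T} (hs : 0 < (s : ℝ≥0))
    (hsT : (s : ℝ≥0) < T) :
    Q.map (β s) = betaMeasure (m * (s : ℝ≥0)) (m * ((T : ℝ) - (s : ℝ≥0))) := by
  have hβm := hβ.measurable
  obtain ⟨Ω', _, Q', _, γ, hγ, hlaw⟩ := hβ.law
  have hγm := hγ.measurable
  have h := congrArg (fun μ ↦ μ.map (fun f : Set.Iic T → ℝ ↦ f s)) hlaw
  beta_reduce at h
  rw [Measure.map_map (by fun_prop) (by fun_prop), Measure.map_map (by fun_prop) (by fun_prop)] at h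
  rw [← hγ.map_ratio hm hs hsT]
  exact h

theorem ae_eval_zero (hβ : IsGammaBridge m T β Q) {s : Set.Iic T} (hs : (s : ℝ≥0) = 0) :
    ∀ᵐ ω ∂Q, β s ω = 0 := by
  have hβm := hβ.measurable
  obtain ⟨Ω', _, Q', _, γ, hγ, hlaw⟩ := hβ.law
  have hγm := hγ.measurable
  have h := congrArg (fun μ ↦ μ.map (fun f : Set.Iic T → ℝ ↦ f s)) hlaw
  beta_reduce at h
  rw [Measure.map_map (by fun_prop) (by fun_prop), Measure.map_map (by fun_prop) (by fun_prop)] at h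
  refine ae_of_ae_map (p := fun x : ℝ ↦ x = 0) (hβm s).aemeasurable ?_
  have h' : Q.map (β s) = Q'.map (fun ω' ↦ γ s ω' / γ T ω') := h
  rw [h', ae_map_iff (p := fun x : ℝ ↦ x = 0) (by fun_prop) (measurableSet_singleton (0 : ℝ))]
  filter_upwards [hγ.zero] with ω hω
  simp [hs, hω]

theorem map_pair (hβ : IsGammaBridge m T β Q) (hm : 0 < m) {s t : Set.Iic T} (hst : s < t)
    (htT : (t : ℝ≥0) < T) :
    Q.map (fun ω ↦ (β s ω, β t ω)) =
      ((Q.map (β s)).prod (betaMeasure (m * (((t : ℝ≥0) : ℝ) - (s : ℝ≥0)))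
        (m * ((T : ℝ) - (t : ℝ≥0))))).map (fun q ↦ (q.1, q.1 + (1 - q.1) * q.2)) := by
  have hβm := hβ.measurable
  obtain ⟨Ω', _, Q', _, γ, hγ, hlaw⟩ := hβ.law
  have hγm := hγ.measurable
  have h := congrArg (fun μ ↦ μ.map (fun f : Set.Iic T → ℝ ↦ f s)) hlaw
  have h2 := congrArg (fun μ ↦ μ.map (fun f : Set.Iic T → ℝ ↦ (f s, f t))) hlaw
  beta_reduce at h h2
  rw [Measure.map_map (by fun_prop) (by fun_prop), Measure.map_map (by fun_prop) (by fun_prop)]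
    at h h2
  have h' : Q.map (β s) = Q'.map (fun ω' ↦ γ s ω' / γ T ω') := h
  rw [h', ← hγ.map_ratio_pair hm hst htT]
  exact h2

end IsGammaBridge

/-- Given `X` and `ξ_s`, the claims process at time `t` is `ξ_s + (X - ξ_s) V` with an independent
beta variable `V`. -/
theorem lintegral_claimsProcess_pair {Ω : Type*} [MeasurableSpace Ω] {Q : Measure Ω}
    [IsProbabilityMeasure Q] {m : ℝ} (hm : 0 < m) {T : ℝ≥0} {X : Ω → ℝ} (hX : Measurable X)
    {β : Set.Iic T → Ω → ℝ} (hβ : IsGammaBridge m T β Q)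
    (hindep : IndepFun X (fun ω (t : Set.Iic T) ↦ β t ω) Q) {s t : Set.Iic T} (hst : s < t)
    (htT : (t : ℝ≥0) < T) {f : ℝ × ℝ → ℝ≥0∞} (hf : Measurable f) :
    ∫⁻ ω, f (claimsProcess X β s ω, claimsProcess X β t ω) ∂Q =
      ∫⁻ ω, ∫⁻ v, f (claimsProcess X β s ω,
        claimsProcess X β s ω + (X ω - claimsProcess X β s ω) * v)
          ∂betaMeasure (m * (((t : ℝ≥0) : ℝ) - (s : ℝ≥0))) (m * ((T : ℝ) - (t : ℝ≥0))) ∂Q := by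
  have hβm := hβ.measurable
  have hst' : ((s : ℝ≥0) : ℝ) < (t : ℝ≥0) := hst
  have htT' : ((t : ℝ≥0) : ℝ) < T := htT
  have := isProbabilityMeasureBeta (mul_pos hm (sub_pos.2 hst')) (mul_pos hm (sub_pos.2 htT'))
  have hs : IndepFun X (β s) Q :=
    hindep.comp (φ := id) (ψ := fun f : Set.Iic T → ℝ ↦ f s) measurable_id (by fun_prop)
  have hst2 : IndepFun X (fun ω ↦ (β s ω, β t ω)) Q :=
    hindep.comp (φ := id) (ψ := fun f : Set.Iic T → ℝ ↦ (f s, f t)) measurable_id (by fun_prop)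
  have hlaw := (indepFun_iff_map_prod_eq_prod_map_map (by fun_prop) (by fun_prop)).1 hs
  have hlaw2 := (indepFun_iff_map_prod_eq_prod_map_map (by fun_prop) (by fun_prop)).1 hst2
  have := Measure.isProbabilityMeasure_map (μ := Q) (hβm s).aemeasurable
  have := Measure.isProbabilityMeasure_map (μ := Q) hX.aemeasurable
  have hL : ∫⁻ ω, f (X ω * β s ω, X ω * β t ω) ∂Q =
      ∫⁻ q : ℝ × ℝ × ℝ, f (q.1 * q.2.1, q.1 * q.2.2)
        ∂(Q.map (fun ω ↦ (X ω, (β s ω, β t ω)))) := by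
    rw [lintegral_map (by fun_prop) (by fun_prop)]
  have hR : ∀ B : Measure ℝ, SFinite B →
      ∫⁻ ω, ∫⁻ v, f (X ω * β s ω, X ω * β s ω + (X ω - X ω * β s ω) * v) ∂B ∂Q =
      ∫⁻ q : ℝ × ℝ, ∫⁻ v, f (q.1 * q.2, q.1 * q.2 + (q.1 - q.1 * q.2) * v) ∂B
        ∂(Q.map (fun ω ↦ (X ω, β s ω))) := by
    intro B _
    rw [lintegral_map (by fun_prop) (by fun_prop)]
  simp only [claimsProcess]
  rw [hL, hR _ inferInstance, hlaw, hlaw2, hβ.map_pair hm hst htT, lintegral_prod _ (by fun_prop),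
    lintegral_prod _ (by fun_prop)]
  refine lintegral_congr fun x ↦ ?_
  rw [lintegral_map (by fun_prop) (by fun_prop), lintegral_prod _ (by fun_prop)]
  refine lintegral_congr fun z ↦ lintegral_congr fun v ↦ ?_
  rw [show x * (z + (1 - z) * v) = x * z + (x - x * z) * v by ring]

/-- The integral of the weight as an extended nonnegative number. -/
noncomputable def weightLIntegral (m : ℝ) (T : ℝ≥0) (p : ℝ → ℝ) (t : ℝ≥0) (y : ℝ) : ℝ≥0∞ :=
  ∫⁻ x in Ioi y, ENNReal.ofReal (weight m T p t y x)

theorem measurable_setLIntegral_Ioi {F : ℝ × ℝ → ℝ≥0∞} (hF : Measurable F) :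
    Measurable fun y ↦ ∫⁻ x in Ioi y, F (y, x) := by
  have hS : MeasurableSet {q : ℝ × ℝ | q.1 < q.2} := measurableSet_lt measurable_fst measurable_snd
  have h : (fun y ↦ ∫⁻ x in Ioi y, F (y, x)) =
      fun y ↦ ∫⁻ x, ({q : ℝ × ℝ | q.1 < q.2}.indicator F) (y, x) := by
    ext y
    rw [← lintegral_indicator measurableSet_Ioi]
    rfl
  rw [h]
  exact (hF.indicator hS).lintegral_prod_right'

section Weight

variable {m : ℝ} {T : ℝ≥0} {p : ℝ → ℝ}

theorem measurable_weight (hp : Measurable p) (t : ℝ≥0) :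
    Measurable fun q : ℝ × ℝ ↦ weight m T p t q.1 q.2 := by
  unfold weight
  fun_prop

theorem measurable_weight_right (hp : Measurable p) (t : ℝ≥0) (y : ℝ) :
    Measurable (weight m T p t y) :=
  (measurable_weight hp t).comp measurable_prodMk_left

theorem weight_nonneg (hp0 : ∀ x, 0 ≤ p x) (t : ℝ≥0) {y x : ℝ} (hy : 0 ≤ y) (hx : y < x) :
    0 ≤ weight m T p t y x :=
  mul_nonneg (mul_nonneg (hp0 x) (Real.rpow_nonneg (hy.trans hx.le) _))
    (Real.rpow_nonneg (sub_nonneg.2 hx.le) _)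

theorem weight_zero_zero {x : ℝ} (hx : 0 < x) : weight m T p 0 0 x = p x := by
  rw [weight, sub_zero, NNReal.coe_zero, sub_zero, mul_assoc, ← Real.rpow_add hx]
  simp

theorem measurable_weightLIntegral (hp : Measurable p) (t : ℝ≥0) :
    Measurable (weightLIntegral m T p t) :=
  measurable_setLIntegral_Ioi (F := fun q ↦ ENNReal.ofReal (weight m T p t q.1 q.2))
    (measurable_weight hp t).ennreal_ofReal

theorem measurable_setLIntegral_weight_mul (hp : Measurable p) (t : ℝ≥0) {g : ℝ × ℝ → ℝ≥0∞}
    (hg : Measurable g) :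
    Measurable fun y ↦ ∫⁻ x in Ioi y, ENNReal.ofReal (weight m T p t y x) * g (y, x) :=
  measurable_setLIntegral_Ioi (F := fun q ↦ ENNReal.ofReal (weight m T p t q.1 q.2) * g q)
    ((measurable_weight hp t).ennreal_ofReal.mul hg)

/-- The kernel identity behind the Markov property: mixing rescaled beta densities over the weight
at time `s` gives the weight at time `t`. -/
theorem weight_mul_betaPDFReal (m : ℝ) (T : ℝ≥0) (p : ℝ → ℝ) (s t : ℝ≥0) {ξ x : ℝ} (hx : ξ < x)
    (y : ℝ) :
    weight m T p s ξ x * ((x - ξ)⁻¹ *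
      betaPDFReal (m * ((t : ℝ) - s)) (m * ((T : ℝ) - t)) ((y - ξ) / (x - ξ))) =
    {q : ℝ × ℝ | ξ < q.1 ∧ q.1 < q.2}.indicator (fun q ↦
      (q.1 - ξ) ^ (m * ((t : ℝ) - s) - 1) / beta (m * ((t : ℝ) - s)) (m * ((T : ℝ) - t)) *
      weight m T p t q.1 q.2) (y, x) := by
  have hxξ : 0 < x - ξ := sub_pos.2 hx
  have hiff : (0 < (y - ξ) / (x - ξ) ∧ (y - ξ) / (x - ξ) < 1) ↔
      (y, x) ∈ {q : ℝ × ℝ | ξ < q.1 ∧ q.1 < q.2} := by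
    rw [div_lt_one hxξ, div_pos_iff_of_pos_right hxξ]
    simp
  rw [indicator_apply, betaPDFReal]
  simp only [hiff]
  split_ifs with hy
  · have h1 : 0 < y - ξ := sub_pos.2 hy.1
    have h2 : 0 < x - y := sub_pos.2 hy.2
    have e1 : 1 - (y - ξ) / (x - ξ) = (x - y) / (x - ξ) := by field_simp; ring
    simp only [weight]
    rw [e1, Real.div_rpow h1.le hxξ.le, Real.div_rpow h2.le hxξ.le]
    have e2 : (x - ξ) ^ (m * ((T : ℝ) - s) - 1) = (x - ξ) * (x - ξ) ^ (m * ((t : ℝ) - s) - 1) *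
        (x - ξ) ^ (m * ((T : ℝ) - t) - 1) := by
      rw [show m * ((T : ℝ) - s) - 1 = 1 + (m * ((t : ℝ) - s) - 1) + (m * ((T : ℝ) - t) - 1) by
        ring, Real.rpow_add hxξ, Real.rpow_add hxξ, Real.rpow_one]
    rw [e2]
    have h3 : 0 < (x - ξ) ^ (m * ((t : ℝ) - s) - 1) := by positivity
    have h4 : 0 < (x - ξ) ^ (m * ((T : ℝ) - t) - 1) := by positivity
    generalize (x - ξ) ^ (m * ((t : ℝ) - s) - 1) = A at *
    generalize (x - ξ) ^ (m * ((T : ℝ) - t) - 1) = B at *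
    field_simp
  · simp

theorem ofReal_weight_mul_betaPDF (hm : 0 < m) (hp0 : ∀ x, 0 ≤ p x) {s t : ℝ≥0} (hst : s < t)
    (htT : t < T) {ξ x : ℝ} (hξ : 0 ≤ ξ) (hx : ξ < x) (y : ℝ) :
    ENNReal.ofReal (weight m T p s ξ x) * (ENNReal.ofReal (x - ξ)⁻¹ *
      betaPDF (m * ((t : ℝ) - s)) (m * ((T : ℝ) - t)) ((y - ξ) / (x - ξ))) =
    {q : ℝ × ℝ | ξ < q.1 ∧ q.1 < q.2}.indicator (fun q ↦ ENNReal.ofReal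
      ((q.1 - ξ) ^ (m * ((t : ℝ) - s) - 1) / beta (m * ((t : ℝ) - s)) (m * ((T : ℝ) - t))) *
      ENNReal.ofReal (weight m T p t q.1 q.2)) (y, x) := by
  have hβ := beta_pos (mul_pos hm (sub_pos.2 (show (s : ℝ) < t from hst)))
    (mul_pos hm (sub_pos.2 (show (t : ℝ) < T from htT)))
  have hxξ : 0 < x - ξ := sub_pos.2 hx
  rw [betaPDF, ← ENNReal.ofReal_mul (by positivity),
    ← ENNReal.ofReal_mul (weight_nonneg hp0 s hξ hx), weight_mul_betaPDFReal m T p s t hx,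
    indicator_apply, indicator_apply]
  split_ifs with hy
  · have h1 : 0 < y - ξ := sub_pos.2 hy.1
    rw [← ENNReal.ofReal_mul (by positivity)]
  · simp

theorem lintegral_weight_mul_lintegral_betaMeasure (hm : 0 < m) (hp : Measurable p)
    (hp0 : ∀ x, 0 ≤ p x) {s t : ℝ≥0} (hst : s < t) (htT : t < T) {ξ : ℝ} (hξ : 0 ≤ ξ)
    {h : ℝ × ℝ → ℝ≥0∞} (hh : Measurable h) :
    ∫⁻ x in Ioi ξ, ENNReal.ofReal (weight m T p s ξ x) *
        ∫⁻ v, h (ξ + (x - ξ) * v, x) ∂betaMeasure (m * ((t : ℝ) - s)) (m * ((T : ℝ) - t)) =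
      ∫⁻ y in Ioi ξ, ENNReal.ofReal
        ((y - ξ) ^ (m * ((t : ℝ) - s) - 1) / beta (m * ((t : ℝ) - s)) (m * ((T : ℝ) - t))) *
          ∫⁻ x in Ioi y, ENNReal.ofReal (weight m T p t y x) * h (y, x) := by
  have hS : MeasurableSet {q : ℝ × ℝ | ξ < q.1 ∧ q.1 < q.2} :=
    (measurableSet_lt measurable_const measurable_fst).inter
      (measurableSet_lt measurable_fst measurable_snd)
  have hw := measurable_weight (m := m) (T := T) hp t
  have hw' := measurable_weight_right (m := m) (T := T) hp
  set c : ℝ → ℝ≥0∞ := fun y ↦ ENNReal.ofReal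
    ((y - ξ) ^ (m * ((t : ℝ) - s) - 1) / beta (m * ((t : ℝ) - s)) (m * ((T : ℝ) - t))) with hc
  have hcm : Measurable c := by fun_prop
  set k : ℝ × ℝ → ℝ≥0∞ := {q : ℝ × ℝ | ξ < q.1 ∧ q.1 < q.2}.indicator
    (fun q ↦ c q.1 * ENNReal.ofReal (weight m T p t q.1 q.2)) with hk
  have hkm : Measurable k := Measurable.indicator (by fun_prop) hS
  have hL : ∀ x ∈ Ioi ξ, ENNReal.ofReal (weight m T p s ξ x) *
        ∫⁻ v, h (ξ + (x - ξ) * v, x) ∂betaMeasure (m * ((t : ℝ) - s)) (m * ((T : ℝ) - t)) =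
      ∫⁻ y, k (y, x) * h (y, x) := by
    intro x hx
    have hxξ : 0 < x - ξ := sub_pos.2 hx
    have h1 := lintegral_eq_mul_lintegral_comp_add_mul (fun y ↦ k (y, x) * h (y, x))
      (by fun_prop) ξ hxξ
    rw [h1, betaMeasure, lintegral_withDensity_eq_lintegral_mul _ (by fun_prop) (by fun_prop),
      ← lintegral_const_mul _ (by fun_prop), ← lintegral_const_mul _ (by fun_prop)]
    refine lintegral_congr fun v ↦ ?_
    rw [hk, ← ofReal_weight_mul_betaPDF hm hp0 hst htT hξ hx, add_sub_cancel_left,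
      mul_div_cancel_left₀ _ hxξ.ne', Pi.mul_apply, ENNReal.ofReal_inv_of_pos hxξ]
    have h2 : ENNReal.ofReal (x - ξ) * (ENNReal.ofReal (x - ξ))⁻¹ = 1 :=
      ENNReal.mul_inv_cancel (by simpa using hxξ) ENNReal.ofReal_ne_top
    rw [show ∀ A B C D E : ℝ≥0∞, A * (B * (C * D) * E) = (A * C) * (B * (D * E)) by
      intros; ring, h2, one_mul]
  rw [setLIntegral_congr_fun measurableSet_Ioi hL, lintegral_lintegral_swap (by fun_prop),
    ← lintegral_indicator measurableSet_Ioi]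
  refine lintegral_congr fun y ↦ ?_
  rw [indicator_apply]
  split_ifs with hy
  · have h3 : ∀ x, k (y, x) * h (y, x) =
        (Ioi y).indicator (fun x ↦ c y * (ENNReal.ofReal (weight m T p t y x) * h (y, x))) x := by
      intro x
      by_cases hx : y < x
      · have : (y, x) ∈ {q : ℝ × ℝ | ξ < q.1 ∧ q.1 < q.2} := ⟨hy, hx⟩
        rw [hk, indicator_of_mem this, indicator_of_mem (show x ∈ Ioi y from hx), mul_assoc]
      · have : (y, x) ∉ {q : ℝ × ℝ | ξ < q.1 ∧ q.1 < q.2} := fun h ↦ hx h.2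
        rw [hk, indicator_of_notMem this, indicator_of_notMem (show x ∉ Ioi y from hx), zero_mul]
    simp_rw [h3]
    rw [lintegral_indicator measurableSet_Ioi, Measure.restrict_restrict measurableSet_Ioi,
      Ioi_inter_Ioi, max_eq_left (le_of_lt hy), lintegral_const_mul]
    have := hw' t y
    fun_prop
  · have h3 : ∀ x, k (y, x) * h (y, x) = 0 := by
      intro x
      have : (y, x) ∉ {q : ℝ × ℝ | ξ < q.1 ∧ q.1 < q.2} := fun h ↦ hy h.1
      rw [hk, indicator_of_notMem this, zero_mul]
    simp [h3]

end Weight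

section Claims

variable {Ω : Type*} [MeasurableSpace Ω] {Q : Measure Ω} {m : ℝ} {T : ℝ≥0}
  {X : Ω → ℝ} {p : ℝ → ℝ} {β : Set.Iic T → Ω → ℝ}

theorem lintegral_terminal (hX : Measurable X) (hXpos : ∀ᵐ ω ∂Q, 0 < X ω) (hp : Measurable p)
    (hXp : Q.map X = (volume : Measure ℝ).withDensity (fun x ↦ ENNReal.ofReal (p x)))
    {G : ℝ → ℝ≥0∞} (hG : Measurable G) :
    ∫⁻ ω, G (X ω) ∂Q = ∫⁻ x in Ioi 0, ENNReal.ofReal (weight m T p 0 0 x) * G x := by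
  have h0 : ∀ᵐ x, ENNReal.ofReal (p x) ≠ 0 → 0 < x := by
    rw [← ae_withDensity_iff (by fun_prop), ← hXp]
    exact (ae_map_iff hX.aemeasurable measurableSet_Ioi).2 hXpos
  rw [← lintegral_map hG hX, hXp,
    lintegral_withDensity_eq_lintegral_mul _ (by fun_prop) hG,
    ← lintegral_indicator measurableSet_Ioi]
  refine lintegral_congr_ae ?_
  filter_upwards [h0] with x hx
  rw [indicator_apply, Pi.mul_apply]
  split_ifs with h
  · rw [weight_zero_zero h]
  · rw [not_not.1 (mt hx h), zero_mul]

theorem measurable_claimsProcess (hX : Measurable X) (hβ : IsGammaBridge m T β Q)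
    (u : Set.Iic T) : Measurable (claimsProcess X β u) :=
  hX.mul (hβ.measurable u)

theorem lintegral_comp_claimsProcess {ν : Measure ℝ} {u : Set.Iic T} (hp : Measurable p)
    (hν : ∀ g : ℝ × ℝ → ℝ≥0∞, Measurable g → ∫⁻ ω, g (claimsProcess X β u ω, X ω) ∂Q =
      ∫⁻ y, (∫⁻ x in Ioi y, ENNReal.ofReal (weight m T p u y x) * g (y, x)) ∂ν)
    {h : ℝ → ℝ≥0∞} (hh : Measurable h) :
    ∫⁻ ω, h (claimsProcess X β u ω) ∂Q = ∫⁻ y, weightLIntegral m T p u y * h y ∂ν := by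
  rw [hν (fun q ↦ h q.1) (by fun_prop)]
  refine lintegral_congr fun y ↦ ?_
  simp only
  rw [lintegral_mul_const _ (measurable_weight_right hp u y).ennreal_ofReal, weightLIntegral]

variable [IsProbabilityMeasure Q]

/-- The joint law of `ξ_u` and `X` is a mixture of the measures with density `weight`. -/
theorem exists_mixing_measure (hm : 0 < m) (hX : Measurable X) (hXpos : ∀ᵐ ω ∂Q, 0 < X ω)
    (hp : Measurable p) (hp0 : ∀ x, 0 ≤ p x)
    (hXp : Q.map X = (volume : Measure ℝ).withDensity (fun x ↦ ENNReal.ofReal (p x)))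
    (hβ : IsGammaBridge m T β Q) (hindep : IndepFun X (fun ω (t : Set.Iic T) ↦ β t ω) Q)
    {u : Set.Iic T} (huT : (u : ℝ≥0) < T) :
    ∃ ν : Measure ℝ, (∀ᵐ y ∂ν, 0 ≤ y) ∧ ∀ g : ℝ × ℝ → ℝ≥0∞, Measurable g →
      ∫⁻ ω, g (claimsProcess X β u ω, X ω) ∂Q =
        ∫⁻ y, (∫⁻ x in Ioi y, ENNReal.ofReal (weight m T p u y x) * g (y, x)) ∂ν := by
  have hβm := hβ.measurable
  rcases eq_or_lt_of_le (zero_le : 0 ≤ (u : ℝ≥0)) with hu | hu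
  · refine ⟨Measure.dirac 0, by simp [ae_dirac_eq], fun g hg ↦ ?_⟩
    rw [lintegral_dirac' _ (measurable_setLIntegral_weight_mul hp u hg), ← hu,
      ← lintegral_terminal hX hXpos hp hXp (by fun_prop)]
    refine lintegral_congr_ae ?_
    filter_upwards [hβ.ae_eval_zero hu.symm] with ω hω
    simp [claimsProcess, hω]
  · let c : ℝ → ℝ≥0∞ := fun y ↦ ENNReal.ofReal ((y - 0) ^ (m * (((u : ℝ≥0) : ℝ) - (0 : ℝ≥0)) - 1) /
      beta (m * (((u : ℝ≥0) : ℝ) - (0 : ℝ≥0))) (m * ((T : ℝ) - (u : ℝ≥0))))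
    have hcm : Measurable c := by fun_prop
    refine ⟨(volume.restrict (Ioi 0)).withDensity c, ?_, fun g hg ↦ ?_⟩
    · refine (withDensity_absolutelyContinuous _ _).ae_le ?_
      filter_upwards [self_mem_ae_restrict measurableSet_Ioi] with y hy using le_of_lt hy
    · rw [lintegral_withDensity_eq_lintegral_mul _ hcm (measurable_setLIntegral_weight_mul hp u hg)]
      simp only [Pi.mul_apply]
      have h1 := lintegral_weight_mul_lintegral_betaMeasure hm hp hp0 hu huT le_rfl hg
      rw [← h1]
      have hlaw : Q.map (β u) = betaMeasure (m * (((u : ℝ≥0) : ℝ) - (0 : ℝ≥0)))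
          (m * ((T : ℝ) - (u : ℝ≥0))) := by
        rw [hβ.map_eval hm hu huT, NNReal.coe_zero, sub_zero]
      have hind : IndepFun X (β u) Q :=
        hindep.comp (φ := id) (ψ := fun f : Set.Iic T → ℝ ↦ f u) measurable_id (by fun_prop)
      have hpair := (indepFun_iff_map_prod_eq_prod_map_map (by fun_prop) (by fun_prop)).1 hind
      rw [← hlaw]
      have := Measure.isProbabilityMeasure_map (μ := Q) (hβm u).aemeasurable
      rw [← lintegral_terminal hX hXpos hp hXp
        (G := fun x ↦ ∫⁻ v, g (0 + (x - 0) * v, x) ∂(Q.map (β u))) (by fun_prop)]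
      have h2 : ∫⁻ ω, g (X ω * β u ω, X ω) ∂Q =
          ∫⁻ q : ℝ × ℝ, g (q.1 * q.2, q.1) ∂(Q.map fun ω ↦ (X ω, β u ω)) := by
        rw [lintegral_map (by fun_prop) (by fun_prop)]
      have := Measure.isProbabilityMeasure_map (μ := Q) hX.aemeasurable
      simp only [claimsProcess]
      rw [h2, hpair, lintegral_prod _ (by fun_prop), lintegral_map (by fun_prop) hX]
      simp

theorem ae_weightLIntegral_claimsProcess (hm : 0 < m) (hX : Measurable X)
    (hXpos : ∀ᵐ ω ∂Q, 0 < X ω) (hp : Measurable p) (hp0 : ∀ x, 0 ≤ p x)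
    (hXp : Q.map X = (volume : Measure ℝ).withDensity (fun x ↦ ENNReal.ofReal (p x)))
    (hβ : IsGammaBridge m T β Q) (hindep : IndepFun X (fun ω (t : Set.Iic T) ↦ β t ω) Q)
    {u : Set.Iic T} (huT : (u : ℝ≥0) < T) :
    ∀ᵐ ω ∂Q, 0 ≤ claimsProcess X β u ω ∧
      weightLIntegral m T p u (claimsProcess X β u ω) ≠ 0 ∧
      weightLIntegral m T p u (claimsProcess X β u ω) ≠ ∞ := by
  obtain ⟨ν, hν0, hν⟩ := exists_mixing_measure hm hX hXpos hp hp0 hXp hβ hindep huT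
  have hWm := measurable_weightLIntegral (m := m) (T := T) hp u
  have hξ := measurable_claimsProcess hX hβ u
  have h1 := lintegral_comp_claimsProcess hp hν (h := fun _ ↦ 1) measurable_const
  have hfin : ∀ᵐ y ∂ν, weightLIntegral m T p u y < ∞ := by
    refine ae_lt_top hWm ?_
    simp only [mul_one] at h1
    rw [← h1]
    simp
  let S : Set ℝ := {y | 0 ≤ y ∧ weightLIntegral m T p u y ≠ 0 ∧ weightLIntegral m T p u y ≠ ∞}
  have hS : MeasurableSet S := measurableSet_Ici.inter
    ((hWm (measurableSet_singleton 0).compl).inter (hWm (measurableSet_singleton ∞).compl))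
  have h2 := lintegral_comp_claimsProcess hp hν (h := Sᶜ.indicator 1)
    (measurable_one.indicator hS.compl)
  have h3 : ∫⁻ y, weightLIntegral m T p u y * Sᶜ.indicator 1 y ∂ν = 0 := by
    rw [← lintegral_zero (μ := ν)]
    refine lintegral_congr_ae ?_
    filter_upwards [hν0, hfin] with y hy0 hy
    by_cases hyS : y ∈ S
    · simp [hyS]
    · have : weightLIntegral m T p u y = 0 := by
        by_contra hne
        exact hyS ⟨hy0, hne, hy.ne⟩
      simp [this]
  rw [h3] at h2
  replace h2 := (lintegral_eq_zero_iff ((measurable_one.indicator hS.compl).comp hξ)).1 h2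
  filter_upwards [h2] with ω hω
  by_contra hne
  have : claimsProcess X β u ω ∈ Sᶜ := hne
  simp [Function.comp_apply, this] at hω

/-- The conditional law of `X` given `ξ_u` has density `weight / weightLIntegral`. -/
theorem lintegral_claimsProcess_terminal (hm : 0 < m) (hX : Measurable X)
    (hXpos : ∀ᵐ ω ∂Q, 0 < X ω) (hp : Measurable p) (hp0 : ∀ x, 0 ≤ p x)
    (hXp : Q.map X = (volume : Measure ℝ).withDensity (fun x ↦ ENNReal.ofReal (p x)))
    (hβ : IsGammaBridge m T β Q) (hindep : IndepFun X (fun ω (t : Set.Iic T) ↦ β t ω) Q)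
    {u : Set.Iic T} (huT : (u : ℝ≥0) < T) {g : ℝ × ℝ → ℝ≥0∞} (hg : Measurable g) :
    ∫⁻ ω, g (claimsProcess X β u ω, X ω) ∂Q =
      ∫⁻ ω, (∫⁻ x in Ioi (claimsProcess X β u ω),
        ENNReal.ofReal (weight m T p u (claimsProcess X β u ω) x) * g (claimsProcess X β u ω, x)) /
          weightLIntegral m T p u (claimsProcess X β u ω) ∂Q := by
  obtain ⟨ν, hν0, hν⟩ := exists_mixing_measure hm hX hXpos hp hp0 hXp hβ hindep huT
  have hWm := measurable_weightLIntegral (m := m) (T := T) hp u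
  have hJm : Measurable fun y ↦ ∫⁻ x in Ioi y, ENNReal.ofReal (weight m T p u y x) * g (y, x) :=
    measurable_setLIntegral_weight_mul hp u hg
  have h1 := lintegral_comp_claimsProcess hp hν (h := fun _ ↦ 1) measurable_const
  have hfin : ∀ᵐ y ∂ν, weightLIntegral m T p u y < ∞ := by
    refine ae_lt_top hWm ?_
    simp only [mul_one] at h1
    rw [← h1]
    simp
  rw [hν g hg, lintegral_comp_claimsProcess hp hν
    (h := fun y ↦ (∫⁻ x in Ioi y, ENNReal.ofReal (weight m T p u y x) * g (y, x)) /
      weightLIntegral m T p u y) (hJm.div hWm)]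
  refine lintegral_congr_ae ?_
  filter_upwards [hfin] with y hy
  by_cases h0 : weightLIntegral m T p u y = 0
  · have hw : Measurable fun x ↦ ENNReal.ofReal (weight m T p u y x) :=
      (measurable_weight_right hp u y).ennreal_ofReal
    have h0' := h0
    rw [weightLIntegral, lintegral_eq_zero_iff hw] at h0'
    rw [h0, zero_mul, ← lintegral_zero (μ := volume.restrict (Ioi y))]
    refine lintegral_congr_ae ?_
    filter_upwards [h0'] with x hx
    rw [hx, Pi.zero_apply, zero_mul]
  · exact (ENNReal.mul_div_cancel h0 hy.ne).symm

/-- The conditional law of `ξ_t` given `ξ_s`. -/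
theorem lintegral_claimsProcess_transition (hm : 0 < m) (hX : Measurable X)
    (hXpos : ∀ᵐ ω ∂Q, 0 < X ω) (hp : Measurable p) (hp0 : ∀ x, 0 ≤ p x)
    (hXp : Q.map X = (volume : Measure ℝ).withDensity (fun x ↦ ENNReal.ofReal (p x)))
    (hβ : IsGammaBridge m T β Q) (hindep : IndepFun X (fun ω (t : Set.Iic T) ↦ β t ω) Q)
    {s t : Set.Iic T} (hst : s < t) (htT : (t : ℝ≥0) < T) {f : ℝ × ℝ → ℝ≥0∞} (hf : Measurable f) :
    ∫⁻ ω, f (claimsProcess X β s ω, claimsProcess X β t ω) ∂Q =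
      ∫⁻ ω, (∫⁻ y in Ioi (claimsProcess X β s ω), ENNReal.ofReal
        ((y - claimsProcess X β s ω) ^ (m * (((t : ℝ≥0) : ℝ) - (s : ℝ≥0)) - 1) /
          beta (m * (((t : ℝ≥0) : ℝ) - (s : ℝ≥0))) (m * ((T : ℝ) - (t : ℝ≥0)))) *
            (weightLIntegral m T p t y * f (claimsProcess X β s ω, y))) /
          weightLIntegral m T p s (claimsProcess X β s ω) ∂Q := by
  have hst' : ((s : ℝ≥0) : ℝ) < (t : ℝ≥0) := hst
  have htT' : ((t : ℝ≥0) : ℝ) < T := htT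
  have := isProbabilityMeasureBeta (mul_pos hm (sub_pos.2 hst')) (mul_pos hm (sub_pos.2 htT'))
  have hsT : (s : ℝ≥0) < T := lt_trans (show (s : ℝ≥0) < t from hst) htT
  rw [lintegral_claimsProcess_pair hm hX hβ hindep hst htT hf,
    lintegral_claimsProcess_terminal hm hX hXpos hp hp0 hXp hβ hindep hsT
      (g := fun q ↦ ∫⁻ v, f (q.1, q.1 + (q.2 - q.1) * v)
        ∂betaMeasure (m * (((t : ℝ≥0) : ℝ) - (s : ℝ≥0))) (m * ((T : ℝ) - (t : ℝ≥0))))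
      (by fun_prop)]
  refine lintegral_congr_ae ?_
  filter_upwards [ae_weightLIntegral_claimsProcess hm hX hXpos hp hp0 hXp hβ hindep hsT] with ω hω
  have h1 := lintegral_weight_mul_lintegral_betaMeasure hm hp hp0 (s := s) hst htT hω.1
    (h := fun q ↦ f (claimsProcess X β s ω, q.1)) (by fun_prop)
  simp only at h1 ⊢
  rw [h1]
  congr 1
  refine lintegral_congr fun y ↦ ?_
  rw [lintegral_mul_const _ (measurable_weight_right hp t y).ennreal_ofReal, weightLIntegral]

end Claims

theorem measurable_setIntegral_Ioi {F : ℝ × ℝ → ℝ} (hF : Measurable F) :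
    Measurable fun y ↦ ∫ x in Ioi y, F (y, x) := by
  have hS : MeasurableSet {q : ℝ × ℝ | q.1 < q.2} := measurableSet_lt measurable_fst measurable_snd
  have h : (fun y ↦ ∫ x in Ioi y, F (y, x)) =
      fun y ↦ ∫ x, ({q : ℝ × ℝ | q.1 < q.2}.indicator F) (y, x) := by
    ext y
    rw [← integral_indicator measurableSet_Ioi]
    rfl
  rw [h]
  exact (hF.indicator hS).stronglyMeasurable.integral_prod_right'.measurable

section Weight

variable {m : ℝ} {T : ℝ≥0} {p : ℝ → ℝ}

theorem measurable_weightIntegral (hp : Measurable p) (t : ℝ≥0) :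
    Measurable (weightIntegral m T p t) :=
  measurable_setIntegral_Ioi (measurable_weight hp t)

theorem ae_weight_nonneg (hp0 : ∀ x, 0 ≤ p x) (t : ℝ≥0) {y : ℝ} (hy : 0 ≤ y) :
    0 ≤ᵐ[volume.restrict (Ioi y)] weight m T p t y := by
  filter_upwards [self_mem_ae_restrict measurableSet_Ioi] with x hx
  exact weight_nonneg hp0 t hy hx

theorem weightIntegral_eq_toReal (hp : Measurable p) (hp0 : ∀ x, 0 ≤ p x) (t : ℝ≥0) {y : ℝ}
    (hy : 0 ≤ y) : weightIntegral m T p t y = (weightLIntegral m T p t y).toReal :=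
  integral_eq_lintegral_of_nonneg_ae (ae_weight_nonneg hp0 t hy)
    (measurable_weight_right hp t y).aestronglyMeasurable

theorem integrableOn_weight_iff (hp : Measurable p) (hp0 : ∀ x, 0 ≤ p x) (t : ℝ≥0) {y : ℝ}
    (hy : 0 ≤ y) :
    IntegrableOn (weight m T p t y) (Ioi y) ↔ weightLIntegral m T p t y ≠ ∞ := by
  rw [IntegrableOn, ← lt_top_iff_ne_top, weightLIntegral,
    ← hasFiniteIntegral_iff_ofReal (ae_weight_nonneg hp0 t hy)]
  exact ⟨fun h ↦ h.2, fun h ↦ ⟨(measurable_weight_right hp t y).aestronglyMeasurable, h⟩⟩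

theorem lintegral_weightLIntegral (hm : 0 < m) (hp : Measurable p) (hp0 : ∀ x, 0 ≤ p x)
    {s t : ℝ≥0} (hst : s < t) (htT : t < T) {ξ : ℝ} (hξ : 0 ≤ ξ) :
    ∫⁻ y in Ioi ξ, ENNReal.ofReal
      ((y - ξ) ^ (m * ((t : ℝ) - s) - 1) / beta (m * ((t : ℝ) - s)) (m * ((T : ℝ) - t))) *
        weightLIntegral m T p t y = weightLIntegral m T p s ξ := by
  have := isProbabilityMeasureBeta (mul_pos hm (sub_pos.2 (show (s : ℝ) < t from hst)))
    (mul_pos hm (sub_pos.2 (show (t : ℝ) < T from htT)))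
  have h := lintegral_weight_mul_lintegral_betaMeasure hm hp hp0 hst htT hξ (h := fun _ ↦ 1)
    measurable_const
  simp only [lintegral_const, measure_univ, mul_one] at h
  exact h.symm

theorem ae_weightLIntegral_lt_top (hm : 0 < m) (hp : Measurable p) (hp0 : ∀ x, 0 ≤ p x)
    {s t : ℝ≥0} (hst : s < t) (htT : t < T) {ξ : ℝ} (hξ : 0 ≤ ξ)
    (hW : weightLIntegral m T p s ξ ≠ ∞) :
    ∀ᵐ y, ξ < y → weightLIntegral m T p t y < ∞ := by
  have hβ := beta_pos (mul_pos hm (sub_pos.2 (show (s : ℝ) < t from hst)))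
    (mul_pos hm (sub_pos.2 (show (t : ℝ) < T from htT)))
  rw [← lintegral_weightLIntegral hm hp hp0 hst htT hξ] at hW
  have hWm := measurable_weightLIntegral (m := m) (T := T) hp t
  have h := ae_lt_top (by fun_prop) hW
  rw [ae_restrict_iff' measurableSet_Ioi] at h
  filter_upwards [h] with y hy hξy
  have h1 : 0 < y - ξ := sub_pos.2 hξy
  refine ENNReal.lt_top_of_mul_ne_top_right (hy hξy).ne ?_
  rw [Ne, ENNReal.ofReal_eq_zero, not_le]
  positivity

/-- The transition density of the claims process, as an extended nonnegative number. -/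
noncomputable def transitionDensity (m : ℝ) (T : ℝ≥0) (p : ℝ → ℝ) (s t : ℝ≥0) (ξ y : ℝ) : ℝ≥0∞ :=
  {q : ℝ × ℝ | q.1 < q.2}.indicator (fun q ↦ ENNReal.ofReal
    ((q.2 - q.1) ^ (m * ((t : ℝ) - s) - 1) / beta (m * ((t : ℝ) - s)) (m * ((T : ℝ) - t))) *
      weightLIntegral m T p t q.2 / weightLIntegral m T p s q.1) (ξ, y)

theorem measurable_transitionDensity (hp : Measurable p) (s t : ℝ≥0) :
    Measurable fun q : ℝ × ℝ ↦ transitionDensity m T p s t q.1 q.2 := by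
  have hS : MeasurableSet {q : ℝ × ℝ | q.1 < q.2} := measurableSet_lt measurable_fst measurable_snd
  have h1 := measurable_weightLIntegral (m := m) (T := T) hp s
  have h2 := measurable_weightLIntegral (m := m) (T := T) hp t
  unfold transitionDensity
  exact Measurable.indicator (by fun_prop) hS

theorem measurable_transitionDensity_right (hp : Measurable p) (s t : ℝ≥0) (ξ : ℝ) :
    Measurable (transitionDensity m T p s t ξ) :=
  (measurable_transitionDensity hp s t).comp measurable_prodMk_left

theorem lintegral_transitionDensity_mul (hp : Measurable p) (s t : ℝ≥0) {ξ : ℝ} {f : ℝ → ℝ≥0∞}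
    (hf : Measurable f) :
    ∫⁻ y, transitionDensity m T p s t ξ y * f y =
      (∫⁻ y in Ioi ξ, ENNReal.ofReal
        ((y - ξ) ^ (m * ((t : ℝ) - s) - 1) / beta (m * ((t : ℝ) - s)) (m * ((T : ℝ) - t))) *
          (weightLIntegral m T p t y * f y)) / weightLIntegral m T p s ξ := by
  have h2 := measurable_weightLIntegral (m := m) (T := T) hp t
  rw [div_eq_mul_inv, ← lintegral_mul_const _ (by fun_prop),
    ← lintegral_indicator measurableSet_Ioi]
  refine lintegral_congr fun y ↦ ?_
  rw [transitionDensity, indicator_apply, indicator_apply]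
  by_cases hy : ξ < y
  · rw [if_pos (show (ξ, y) ∈ {q : ℝ × ℝ | q.1 < q.2} from hy), if_pos (show y ∈ Ioi ξ from hy),
      div_eq_mul_inv]
    ring
  · rw [if_neg (show (ξ, y) ∉ {q : ℝ × ℝ | q.1 < q.2} from hy), if_neg (show y ∉ Ioi ξ from hy),
      zero_mul]

theorem measurable_arrowDebreu (hp : Measurable p) (P : ℝ≥0 → ℝ≥0 → ℝ) (s t : ℝ≥0) :
    Measurable fun q : ℝ × ℝ ↦ arrowDebreu m T p P s t q.2 q.1 := by
  have hS : MeasurableSet {q : ℝ × ℝ | q.2 < q.1} := measurableSet_lt measurable_snd measurable_fst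
  have h1 := measurable_weightIntegral (m := m) (T := T) hp s
  have h2 := measurable_weightIntegral (m := m) (T := T) hp t
  have h3 : Measurable fun q : ℝ × ℝ ↦
      (Ioi q.2).indicator (fun y ↦ (y - q.2) ^ (m * ((t : ℝ) - s) - 1)) q.1 :=
    Measurable.indicator (f := fun q : ℝ × ℝ ↦ (q.1 - q.2) ^ (m * ((t : ℝ) - s) - 1))
      (by fun_prop) hS
  unfold arrowDebreu
  fun_prop

theorem arrowDebreu_of_le (P : ℝ≥0 → ℝ≥0 → ℝ) (s t : ℝ≥0) {ξ y : ℝ} (hy : y ≤ ξ) :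
    arrowDebreu m T p P s t ξ y = 0 := by
  rw [arrowDebreu, indicator_of_notMem (show y ∉ Ioi ξ from not_lt.2 hy)]
  simp

theorem weightIntegral_nonneg (hp : Measurable p) (hp0 : ∀ x, 0 ≤ p x) (t : ℝ≥0) {y : ℝ}
    (hy : 0 ≤ y) : 0 ≤ weightIntegral m T p t y := by
  rw [weightIntegral_eq_toReal hp hp0 t hy]
  exact ENNReal.toReal_nonneg

theorem arrowDebreu_nonneg (hm : 0 < m) (hp : Measurable p) (hp0 : ∀ x, 0 ≤ p x)
    {P : ℝ≥0 → ℝ≥0 → ℝ} {s t : ℝ≥0} (hst : s < t) (htT : t < T) (hP : 0 < P s t) {ξ : ℝ}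
    (hξ : 0 ≤ ξ) (y : ℝ) : 0 ≤ arrowDebreu m T p P s t ξ y := by
  rcases le_or_gt y ξ with hy | hy
  · rw [arrowDebreu_of_le P s t hy]
  · have hβ := beta_pos (mul_pos hm (sub_pos.2 (show (s : ℝ) < t from hst)))
      (mul_pos hm (sub_pos.2 (show (t : ℝ) < T from htT)))
    have h1 : 0 < y - ξ := sub_pos.2 hy
    rw [arrowDebreu, indicator_of_mem (show y ∈ Ioi ξ from hy)]
    exact mul_nonneg (mul_nonneg hP.le (by positivity))
      (div_nonneg (weightIntegral_nonneg hp hp0 t (hξ.trans hy.le))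
        (weightIntegral_nonneg hp hp0 s hξ))

theorem ofReal_arrowDebreu_ae_eq (hm : 0 < m) (hp : Measurable p) (hp0 : ∀ x, 0 ≤ p x)
    {P : ℝ≥0 → ℝ≥0 → ℝ} {s t : ℝ≥0} (hst : s < t) (htT : t < T) (hP : 0 < P s t) {ξ : ℝ}
    (hξ : 0 ≤ ξ) (hW0 : weightLIntegral m T p s ξ ≠ 0) (hW : weightLIntegral m T p s ξ ≠ ∞) :
    (fun y ↦ ENNReal.ofReal (arrowDebreu m T p P s t ξ y)) =ᵐ[volume]
      fun y ↦ ENNReal.ofReal (P s t) * transitionDensity m T p s t ξ y := by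
  have hβ := beta_pos (mul_pos hm (sub_pos.2 (show (s : ℝ) < t from hst)))
    (mul_pos hm (sub_pos.2 (show (t : ℝ) < T from htT)))
  filter_upwards [ae_weightLIntegral_lt_top hm hp hp0 hst htT hξ hW] with y hy
  rcases le_or_gt y ξ with h | h
  · rw [arrowDebreu_of_le P s t h, transitionDensity,
      indicator_of_notMem (show (ξ, y) ∉ {q : ℝ × ℝ | q.1 < q.2} from not_lt.2 h)]
    simp
  · have h1 : 0 < y - ξ := sub_pos.2 h
    have h2 : 0 < (weightLIntegral m T p s ξ).toReal := ENNReal.toReal_pos hW0 hW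
    rw [arrowDebreu, transitionDensity,
      indicator_of_mem (show (ξ, y) ∈ {q : ℝ × ℝ | q.1 < q.2} from h),
      indicator_of_mem (show y ∈ Ioi ξ from h), mul_assoc, ENNReal.ofReal_mul hP.le,
      ENNReal.ofReal_mul (by positivity), weightIntegral_eq_toReal hp hp0 t (hξ.trans h.le),
      weightIntegral_eq_toReal hp hp0 s hξ, ENNReal.ofReal_div_of_pos h2,
      ENNReal.ofReal_toReal hW, ENNReal.ofReal_toReal (hy h).ne, mul_div_assoc]

end Weight

section Claims

variable {Ω : Type*} [MeasurableSpace Ω] {Q : Measure Ω} [IsProbabilityMeasure Q] {m : ℝ} {T : ℝ≥0}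
  {X : Ω → ℝ} {p : ℝ → ℝ} {β : Set.Iic T → Ω → ℝ}

/-- The regular conditional law of `ξ_t` given `ξ_s` has density `transitionDensity`. -/
theorem condDistrib_claimsProcess (hm : 0 < m) (hX : Measurable X)
    (hXpos : ∀ᵐ ω ∂Q, 0 < X ω) (hp : Measurable p) (hp0 : ∀ x, 0 ≤ p x)
    (hXp : Q.map X = (volume : Measure ℝ).withDensity (fun x ↦ ENNReal.ofReal (p x)))
    (hβ : IsGammaBridge m T β Q) (hindep : IndepFun X (fun ω (t : Set.Iic T) ↦ β t ω) Q)
    {s t : Set.Iic T} (hst : s < t) (htT : (t : ℝ≥0) < T) :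
    ∀ᵐ ω ∂Q, condDistrib (claimsProcess X β t) (claimsProcess X β s) Q (claimsProcess X β s ω) =
      (volume : Measure ℝ).withDensity (transitionDensity m T p s t (claimsProcess X β s ω)) := by
  have hsT : (s : ℝ≥0) < T := lt_trans (show (s : ℝ≥0) < t from hst) htT
  have hξs := measurable_claimsProcess hX hβ s
  have hξt := measurable_claimsProcess hX hβ t
  have hgood := ae_weightLIntegral_claimsProcess hm hX hXpos hp hp0 hXp hβ hindep hsT
  have hWm := measurable_weightLIntegral (m := m) (T := T) hp s
  have hk := measurable_transitionDensity (m := m) (T := T) hp s t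
  let S : Set ℝ := {y | 0 ≤ y ∧ weightLIntegral m T p s y ≠ 0 ∧ weightLIntegral m T p s y ≠ ∞}
  have hS : MeasurableSet S := measurableSet_Ici.inter
    ((hWm (measurableSet_singleton 0).compl).inter (hWm (measurableSet_singleton ∞).compl))
  let k : ℝ → ℝ → ℝ≥0∞ := fun ξ y ↦ S.indicator 1 ξ * transitionDensity m T p s t ξ y
  have hkm : Measurable (Function.uncurry k) :=
    ((measurable_one.indicator hS).comp measurable_fst).mul hk
  let κ : Kernel ℝ ℝ := Kernel.withDensity (Kernel.const ℝ volume) k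
  have hκ : ∀ ξ ∈ S, κ ξ = volume.withDensity (transitionDensity m T p s t ξ) := by
    intro ξ hξ
    rw [Kernel.withDensity_apply _ hkm, Kernel.const_apply]
    congr 1
    ext y
    simp [k, hξ]
  have hfin : IsFiniteKernel κ := by
    refine ⟨1, ENNReal.one_lt_top, fun ξ ↦ ?_⟩
    by_cases hξ : ξ ∈ S
    · rw [hκ ξ hξ, withDensity_apply _ MeasurableSet.univ, Measure.restrict_univ]
      have h := lintegral_transitionDensity_mul (m := m) (T := T) hp s t (ξ := ξ) (f := fun _ ↦ 1)
        measurable_const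
      simp only [mul_one] at h
      rw [h, lintegral_weightLIntegral hm hp hp0 (show (s : ℝ≥0) < t from hst) htT hξ.1,
        ENNReal.div_self hξ.2.1 hξ.2.2]
    · rw [Kernel.withDensity_apply _ hkm, withDensity_apply _ MeasurableSet.univ]
      simp [k, hξ]
  have hmap : Q.map (fun ω ↦ (claimsProcess X β s ω, claimsProcess X β t ω)) =
      Q.map (claimsProcess X β s) ⊗ₘ κ := by
    refine Measure.ext_of_lintegral _ fun f hf ↦ ?_
    rw [lintegral_map hf (by fun_prop), Measure.lintegral_compProd hf,
      lintegral_map (Measurable.lintegral_kernel_prod_right' hf) hξs,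
      lintegral_claimsProcess_transition hm hX hXpos hp hp0 hXp hβ hindep hst htT hf]
    refine lintegral_congr_ae ?_
    filter_upwards [hgood] with ω hω
    rw [hκ _ hω, lintegral_withDensity_eq_lintegral_mul _
      (measurable_transitionDensity_right hp s t _) (by fun_prop)]
    exact (lintegral_transitionDensity_mul hp s t (f := fun y ↦ f (claimsProcess X β s ω, y))
      (hf.comp measurable_prodMk_left)).symm
  have hae := condDistrib_ae_eq_of_measure_eq_compProd (μ := Q) (claimsProcess X β s)
    hξt.aemeasurable hmap
  filter_upwards [ae_of_ae_map hξs.aemeasurable hae, hgood] with ω h1 h2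
  rw [h1, hκ _ h2]

theorem isArrowDebreuPrice_arrowDebreu (hm : 0 < m) {P : ℝ≥0 → ℝ≥0 → ℝ} (hX : Measurable X)
    (hXpos : ∀ᵐ ω ∂Q, 0 < X ω) (hp : Measurable p) (hp0 : ∀ x, 0 ≤ p x)
    (hXp : Q.map X = (volume : Measure ℝ).withDensity (fun x ↦ ENNReal.ofReal (p x)))
    (hβ : IsGammaBridge m T β Q) (hindep : IndepFun X (fun ω (t : Set.Iic T) ↦ β t ω) Q)
    {s t : Set.Iic T} (hst : s < t) (htT : (t : ℝ≥0) < T) (hP : 0 < P s t) :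
    IsArrowDebreuPrice Q (claimsProcess X β s) (claimsProcess X β t) (P s t)
      (fun y ω ↦ arrowDebreu m T p P s t (claimsProcess X β s ω) y) := by
  have hsT : (s : ℝ≥0) < T := lt_trans (show (s : ℝ≥0) < t from hst) htT
  have hst' : (s : ℝ≥0) < t := hst
  have hgood := ae_weightLIntegral_claimsProcess hm hX hXpos hp hp0 hXp hβ hindep hsT
  refine ⟨?_, ?_, ?_⟩
  · let _ : MeasurableSpace Ω := MeasurableSpace.comap (claimsProcess X β s) inferInstance
    have h : Measurable (claimsProcess X β s) := comap_measurable _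
    exact (measurable_arrowDebreu hp P s t).comp
      (measurable_fst.prodMk (h.comp measurable_snd))
  · filter_upwards [hgood] with ω hω y
    exact arrowDebreu_nonneg hm hp hp0 hst' htT hP hω.1 y
  · filter_upwards [hgood, condDistrib_claimsProcess hm hX hXpos hp hp0 hXp hβ hindep hst htT]
      with ω hω h
    rw [h, withDensity_congr_ae
      (ofReal_arrowDebreu_ae_eq hm hp hp0 hst' htT hP hω.1 hω.2.1 hω.2.2),
      ← withDensity_smul _ (measurable_transitionDensity_right hp _ _ _)]
    rfl

end Claims

section Beta

theorem integral_betaPDFReal_eq_one {a b : ℝ} (ha : 0 < a) (hb : 0 < b) :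
    ∫ v, betaPDFReal a b v = 1 := by
  have hβ := beta_pos ha hb
  have h0 : ∀ v, 0 ≤ betaPDFReal a b v := by
    intro v
    rw [betaPDFReal]
    split_ifs with hv
    · have h1 : 0 < v := hv.1
      have h2 : 0 < 1 - v := sub_pos.2 hv.2
      positivity
    · exact le_rfl
  rw [integral_eq_lintegral_of_nonneg_ae (.of_forall h0) (by fun_prop)]
  have := lintegral_betaPDF_eq_one ha hb
  simp only [betaPDF] at this
  rw [this, ENNReal.toReal_one]

theorem complBeta_eq_integral {a b : ℝ} (ha : 0 < a) (hb : 0 < b) (u : ℝ) :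
    complBeta a b u = ∫ v, (Ioi u).indicator (betaPDFReal a b) v := by
  have hβ := beta_pos ha hb
  have key : ∀ u : ℝ, ∫ v, (Ioi u).indicator (betaPDFReal a b) v =
      1 / beta a b * ∫ z in Ioo (max u 0) 1, z ^ (a - 1) * (1 - z) ^ (b - 1) := by
    intro u
    rw [← integral_const_mul, ← integral_indicator measurableSet_Ioo]
    congr 1
    ext v
    simp only [indicator_apply, betaPDFReal, mem_Ioi, mem_Ioo, max_lt_iff]
    by_cases h1 : u < v <;> by_cases h2 : 0 < v ∧ v < 1
    · simp [h1, h2, mul_assoc]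
    · simp [h1, h2]
    · simp [h1]
    · simp [h1]
  have h1 : ∫ z in Ioo (0 : ℝ) 1, z ^ (a - 1) * (1 - z) ^ (b - 1) = beta a b := by
    have h := key 0
    have h' : (Ioi (0 : ℝ)).indicator (betaPDFReal a b) = betaPDFReal a b := by
      ext v
      rw [indicator_apply]
      split_ifs with hv
      · rfl
      · rw [betaPDFReal, if_neg fun h ↦ hv h.1]
    rw [h', integral_betaPDFReal_eq_one ha hb, max_self] at h
    field_simp at h
    exact h.symm
  rw [complBeta, h1, key u]
  ring

theorem complBeta_of_one_le {a b u : ℝ} (hu : 1 ≤ u) : complBeta a b u = 0 := by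
  rw [complBeta, Ioo_eq_empty (not_lt.2 (hu.trans (le_max_left u 0)))]
  simp

theorem integral_indicator_betaPDFReal_comp {a b : ℝ} (ha : 0 < a) (hb : 0 < b) {ξ x : ℝ}
    (hx : ξ < x) (z : ℝ) :
    ∫ y, (Ioi z).indicator (fun y ↦ betaPDFReal a b ((y - ξ) / (x - ξ))) y =
      (x - ξ) * complBeta a b ((z - ξ) / (x - ξ)) := by
  have hxξ : 0 < x - ξ := sub_pos.2 hx
  rw [complBeta_eq_integral ha hb]
  have h : ∀ y, (Ioi z).indicator (fun y ↦ betaPDFReal a b ((y - ξ) / (x - ξ))) y =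
      (Ioi ((z - ξ) / (x - ξ))).indicator (betaPDFReal a b) ((y - ξ) / (x - ξ)) := by
    intro y
    simp only [indicator_apply, mem_Ioi]
    have : (z - ξ) / (x - ξ) < (y - ξ) / (x - ξ) ↔ z < y := by
      rw [div_lt_div_iff_of_pos_right hxξ, sub_lt_sub_iff_right]
    simp only [this]
  simp_rw [h]
  rw [integral_sub_right_eq_self (fun y ↦ (Ioi ((z - ξ) / (x - ξ))).indicator (betaPDFReal a b)
    (y / (x - ξ))) ξ, Measure.integral_comp_div, abs_of_pos hxξ, smul_eq_mul]

end Beta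

section Reserve

variable {m : ℝ} {T : ℝ≥0} {p : ℝ → ℝ} {P : ℝ≥0 → ℝ≥0 → ℝ}

theorem setIntegral_reserve_numerator (t : ℝ≥0) {y : ℝ} (hy : 0 ≤ y) :
    ∫ x in Ioi y, p x * x ^ (2 - m * T) * (x - y) ^ (m * ((T : ℝ) - t) - 1) =
      ∫ x in Ioi y, x * weight m T p t y x := by
  refine setIntegral_congr_fun measurableSet_Ioi fun x hx ↦ ?_
  have hx0 : 0 < x := hy.trans_lt hx
  simp only [weight]
  rw [show 2 - m * (T : ℝ) = 1 + (1 - m * T) by ring, Real.rpow_add hx0, Real.rpow_one]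
  ring

/-- If the weight is integrable, then so is its first moment, because `X` is integrable. -/
theorem integrableOn_mul_weight (hm : 0 < m) (hp : Measurable p) (hp0 : ∀ x, 0 ≤ p x)
    (hpint : Integrable fun x ↦ x * p x) (t : ℝ≥0) {y : ℝ} (hy : 0 ≤ y)
    (hW : IntegrableOn (weight m T p t y) (Ioi y)) :
    IntegrableOn (fun x ↦ x * weight m T p t y x) (Ioi y) := by
  set e := m * ((T : ℝ) - t) - 1 with he
  set C : ℝ := max 1 ((1 / 2) ^ e) with hC
  have hwm := measurable_weight_right (m := m) (T := T) hp t y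
  refine Integrable.mono' ((hW.const_mul (2 * y + 1)).add (hpint.integrableOn.const_mul C))
    (by fun_prop) ?_
  filter_upwards [self_mem_ae_restrict measurableSet_Ioi] with x hx
  have hyx : y < x := hx
  have hx0 : 0 < x := hy.trans_lt hyx
  have hw := weight_nonneg (m := m) (T := T) hp0 t hy hyx
  have hC1 : 1 ≤ C := le_max_left _ _
  have hxp : 0 ≤ x * p x := mul_nonneg hx0.le (hp0 x)
  rw [Real.norm_of_nonneg (mul_nonneg hx0.le hw), Pi.add_apply]
  rcases le_or_gt x (2 * y + 1) with hxM | hxM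
  · have h1 : 0 ≤ C * (x * p x) := by positivity
    nlinarith
  · have h2 : 0 ≤ (2 * y + 1) * weight m T p t y x := by positivity
    suffices h : weight m T p t y x ≤ C * p x by nlinarith
    set r := (x - y) / x with hr
    have hr0 : 1 / 2 ≤ r := by
      rw [hr, le_div_iff₀ hx0]; linarith
    have hr1 : r ≤ 1 := by
      rw [hr, div_le_one hx0]; linarith
    have hre : r ^ e ≤ C := by
      rcases le_or_gt 0 e with h | h
      · exact (Real.rpow_le_one (by linarith) hr1 h).trans hC1
      · exact (Real.rpow_le_rpow_of_nonpos (by norm_num) hr0 h.le).trans (le_max_right _ _)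
    have hxy : x - y = x * r := by rw [hr]; field_simp
    have hxe : x ^ (1 - m * T) * x ^ e ≤ 1 := by
      rw [← Real.rpow_add hx0, he,
        show 1 - m * (T : ℝ) + (m * ((T : ℝ) - t) - 1) = -(m * t) by ring]
      exact Real.rpow_le_one_of_one_le_of_nonpos (by linarith)
        (neg_nonpos.2 (mul_nonneg hm.le t.2))
    have hxe0 : 0 ≤ x ^ (1 - m * T) * x ^ e := by positivity
    calc weight m T p t y x = (x ^ (1 - m * T) * x ^ e) * r ^ e * p x := by
          rw [weight, hxy, Real.mul_rpow hx0.le (by linarith)]; ring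
      _ ≤ 1 * C * p x := by
          have hr' : 0 ≤ r ^ e := Real.rpow_nonneg (by linarith) _
          have := hp0 x
          gcongr
      _ = C * p x := by ring

theorem integrableOn_weight_mul_affine (hm : 0 < m) (hp : Measurable p) (hp0 : ∀ x, 0 ≤ p x)
    (hpint : Integrable fun x ↦ x * p x) (t : ℝ≥0) {y : ℝ} (hy : 0 ≤ y)
    (hW : IntegrableOn (weight m T p t y) (Ioi y)) (c K : ℝ) :
    IntegrableOn (fun x ↦ weight m T p t y x * (x * c - K)) (Ioi y) := by
  have h := ((integrableOn_mul_weight hm hp hp0 hpint t hy hW).mul_const c).sub (hW.mul_const K)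
  refine h.congr (.of_forall fun x ↦ ?_)
  simp only [Pi.sub_apply]
  ring

theorem criticalIntegral_eq_setIntegral (t : ℝ≥0) (K y : ℝ) :
    criticalIntegral m T p P t K y = ∫ x in Ioi y, weight m T p t y x * (x * P t T - K) := by
  rw [criticalIntegral]
  congr 1
  ext x
  rw [weight]
  ring

theorem weightIntegral_mul_reserve_sub (hm : 0 < m) (hp : Measurable p) (hp0 : ∀ x, 0 ≤ p x)
    (hpint : Integrable fun x ↦ x * p x) {t : ℝ≥0} (K : ℝ) {y : ℝ}
    (hy : y ∈ reserveDomain m T p t) :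
    weightIntegral m T p t y * (reserve m T p P t y - K) = criticalIntegral m T p P t K y := by
  obtain ⟨hy0, hW, hpos⟩ := hy
  have h1 := integrableOn_mul_weight hm hp hp0 hpint t hy0 hW
  have h2 : criticalIntegral m T p P t K y =
      (∫ x in Ioi y, x * weight m T p t y x) * P t T - weightIntegral m T p t y * K := by
    rw [criticalIntegral_eq_setIntegral, weightIntegral, ← integral_mul_const,
      ← integral_mul_const, ← integral_sub (h1.mul_const _) (hW.mul_const _)]
    congr 1
    ext x
    ring
  rw [h2, reserve, setIntegral_reserve_numerator t hy0]
  field_simp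

theorem weightIntegral_mul_payoff (hm : 0 < m) (hp : Measurable p) (hp0 : ∀ x, 0 ≤ p x)
    (hpint : Integrable fun x ↦ x * p x) {t : ℝ≥0} {K ystar : ℝ}
    (hcrit : IsCriticalValue m T p P t K ystar)
    (hcross : MonotoneOn (reserve m T p P t) (reserveDomain m T p t) ∨
      IsSingleCrossing m T p P t K ystar) {y : ℝ} (hy0 : 0 ≤ y) (hne : y ≠ ystar)
    (hW : IntegrableOn (weight m T p t y) (Ioi y)) :
    weightIntegral m T p t y * max (reserve m T p P t y - K) 0 =
      (Ioi ystar).indicator (criticalIntegral m T p P t K) y := by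
  rcases (weightIntegral_nonneg (m := m) (T := T) hp hp0 t hy0).eq_or_lt with h0 | hpos
  · have hw : weight m T p t y =ᵐ[volume.restrict (Ioi y)] 0 :=
      (integral_eq_zero_iff_of_nonneg_ae (ae_weight_nonneg hp0 t hy0) hW).1 h0.symm
    have hF : criticalIntegral m T p P t K y = 0 := by
      rw [criticalIntegral_eq_setIntegral]
      refine integral_eq_zero_of_ae ?_
      filter_upwards [hw] with x hx
      simp [hx]
    rw [← h0, zero_mul, indicator_apply, hF, ite_self]
  · have hy : y ∈ reserveDomain m T p t := ⟨hy0, hW, hpos⟩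
    have hF := weightIntegral_mul_reserve_sub (P := P) hm hp hp0 hpint K hy
    have hsign : IsSingleCrossing m T p P t K ystar := by
      rcases hcross with hmono | h
      · have hK : reserve m T p P t ystar = K := by
          have h := weightIntegral_mul_reserve_sub (P := P) hm hp hp0 hpint K hcrit.1
          rw [hcrit.2] at h
          have := (mul_eq_zero.1 h).resolve_left hcrit.1.2.2.ne'
          linarith
        intro z hz
        rw [← weightIntegral_mul_reserve_sub (P := P) hm hp hp0 hpint K hz, ← hK]
        exact ⟨fun h ↦ mul_nonpos_of_nonneg_of_nonpos hz.2.2.le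
            (sub_nonpos.2 (hmono hz hcrit.1 h.le)),
          fun h ↦ mul_nonneg hz.2.2.le (sub_nonneg.2 (hmono hcrit.1 hz h.le))⟩
      · exact h
    rcases lt_or_gt_of_ne hne with h | h
    · have h1 := (hsign y hy).1 h
      rw [indicator_of_notMem (show y ∉ Ioi ystar from not_lt.2 h.le), max_eq_right, mul_zero]
      rw [← hF] at h1
      exact nonpos_of_mul_nonpos_right h1 hpos
    · have h1 := (hsign y hy).2 h
      rw [indicator_of_mem (show y ∈ Ioi ystar from h), max_eq_left, hF]
      rw [← hF] at h1
      exact nonneg_of_mul_nonneg_right h1 hpos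

end Reserve

section Fubini

variable {m : ℝ} {T : ℝ≥0} {p : ℝ → ℝ} {P : ℝ≥0 → ℝ≥0 → ℝ}

/-- The joint density of `(ξ_t, X)` given `ξ_s = ξ`, up to normalization. -/
noncomputable def jointKernel (m : ℝ) (T : ℝ≥0) (p : ℝ → ℝ) (s t : ℝ≥0) (ξ : ℝ) : ℝ × ℝ → ℝ :=
  {q : ℝ × ℝ | ξ < q.1 ∧ q.1 < q.2}.indicator (fun q ↦
    (q.1 - ξ) ^ (m * ((t : ℝ) - s) - 1) / beta (m * ((t : ℝ) - s)) (m * ((T : ℝ) - t)) *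
      weight m T p t q.1 q.2)

theorem measurable_jointKernel (hp : Measurable p) (s t : ℝ≥0) (ξ : ℝ) :
    Measurable (jointKernel m T p s t ξ) := by
  have hw := measurable_weight (m := m) (T := T) hp t
  exact Measurable.indicator (by fun_prop)
    ((measurableSet_lt measurable_const measurable_fst).inter
      (measurableSet_lt measurable_fst measurable_snd))

theorem jointKernel_of_le (s t : ℝ≥0) {ξ y : ℝ} (hy : y ≤ ξ) (x : ℝ) :
    jointKernel m T p s t ξ (y, x) = 0 :=
  indicator_of_notMem (fun h ↦ not_lt.2 hy h.1) _

theorem jointKernel_of_terminal_le (s t : ℝ≥0) {ξ x : ℝ} (hx : x ≤ ξ) (y : ℝ) :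
    jointKernel m T p s t ξ (y, x) = 0 :=
  indicator_of_notMem (fun h ↦ not_lt.2 hx (h.1.trans h.2)) _

theorem jointKernel_of_lt (s t : ℝ≥0) {ξ y : ℝ} (hy : ξ < y) (x : ℝ) :
    jointKernel m T p s t ξ (y, x) = (Ioi y).indicator (fun x ↦
      (y - ξ) ^ (m * ((t : ℝ) - s) - 1) / beta (m * ((t : ℝ) - s)) (m * ((T : ℝ) - t)) *
        weight m T p t y x) x := by
  rw [jointKernel, indicator_apply, indicator_apply]
  simp [hy]

theorem integrable_jointKernel_mul (hm : 0 < m) (hp : Measurable p) (hp0 : ∀ x, 0 ≤ p x)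
    {s t : ℝ≥0} (hst : s < t) (htT : t < T) {ξ : ℝ} (hξ : 0 ≤ ξ) {φ : ℝ → ℝ} (hφ : Measurable φ)
    (hint : IntegrableOn (fun x ↦ weight m T p s ξ x * φ x) (Ioi ξ)) :
    Integrable (fun q : ℝ × ℝ ↦ jointKernel m T p s t ξ q * φ q.2) (volume.prod volume) := by
  have hβ := beta_pos (mul_pos hm (sub_pos.2 (show (s : ℝ) < t from hst)))
    (mul_pos hm (sub_pos.2 (show (t : ℝ) < T from htT)))
  have := isProbabilityMeasureBeta (mul_pos hm (sub_pos.2 (show (s : ℝ) < t from hst)))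
    (mul_pos hm (sub_pos.2 (show (t : ℝ) < T from htT)))
  have hk := measurable_jointKernel (m := m) (T := T) hp s t ξ
  refine ⟨by fun_prop, ?_⟩
  rw [hasFiniteIntegral_iff_enorm, lintegral_prod _ (by fun_prop)]
  have hinner : ∀ y, ∫⁻ x, ‖jointKernel m T p s t ξ (y, x) * φ x‖ₑ =
      (Ioi ξ).indicator (fun y ↦ ENNReal.ofReal
        ((y - ξ) ^ (m * ((t : ℝ) - s) - 1) / beta (m * ((t : ℝ) - s)) (m * ((T : ℝ) - t))) *
          ∫⁻ x in Ioi y, ENNReal.ofReal (weight m T p t y x) * ‖φ x‖ₑ) y := by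
    intro y
    rcases le_or_gt y ξ with hy | hy
    · rw [indicator_of_notMem (show y ∉ Ioi ξ from not_lt.2 hy)]
      simp [jointKernel_of_le s t hy]
    · have hw := measurable_weight_right (m := m) (T := T) hp t y
      have h1 : 0 < y - ξ := sub_pos.2 hy
      rw [indicator_of_mem (show y ∈ Ioi ξ from hy), ← lintegral_const_mul _ (by fun_prop),
        ← lintegral_indicator measurableSet_Ioi]
      refine lintegral_congr fun x ↦ ?_
      rw [jointKernel_of_lt s t hy, indicator_apply, indicator_apply]
      split_ifs with hx
      · have hw0 := weight_nonneg (m := m) (T := T) hp0 t (hξ.trans hy.le) hx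
        rw [enorm_mul, enorm_mul, Real.enorm_of_nonneg hw0, Real.enorm_of_nonneg (by positivity),
          mul_assoc]
      · simp
  simp_rw [hinner]
  rw [lintegral_indicator measurableSet_Ioi,
    ← lintegral_weight_mul_lintegral_betaMeasure hm hp hp0 hst htT hξ (h := fun q ↦ ‖φ q.2‖ₑ)
      (by fun_prop)]
  simp only [lintegral_const, measure_univ, mul_one]
  have h := hint.2
  rw [hasFiniteIntegral_iff_enorm] at h
  refine lt_of_eq_of_lt (setLIntegral_congr_fun measurableSet_Ioi fun x hx ↦ ?_) h
  rw [enorm_mul, Real.enorm_of_nonneg (weight_nonneg hp0 s hξ hx)]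

theorem integral_indicator_jointKernel (hm : 0 < m) {s t : ℝ≥0} (hst : s < t) (htT : t < T)
    (ξ z x : ℝ) :
    ∫ y, (Ioi z).indicator (fun y ↦ jointKernel m T p s t ξ (y, x)) y =
      (Ioi ξ).indicator (fun x ↦ weight m T p s ξ x *
        complBeta (m * ((t : ℝ) - s)) (m * ((T : ℝ) - t)) ((z - ξ) / (x - ξ))) x := by
  have ha := mul_pos hm (sub_pos.2 (show (s : ℝ) < t from hst))
  have hb := mul_pos hm (sub_pos.2 (show (t : ℝ) < T from htT))
  rcases le_or_gt x ξ with hx | hx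
  · rw [indicator_of_notMem (show x ∉ Ioi ξ from not_lt.2 hx)]
    simp [jointKernel_of_terminal_le s t hx]
  · have hxξ : 0 < x - ξ := sub_pos.2 hx
    have h : ∀ y, (Ioi z).indicator (fun y ↦ jointKernel m T p s t ξ (y, x)) y =
        weight m T p s ξ x * (x - ξ)⁻¹ * (Ioi z).indicator (fun y ↦
          betaPDFReal (m * ((t : ℝ) - s)) (m * ((T : ℝ) - t)) ((y - ξ) / (x - ξ))) y := by
      intro y
      rw [indicator_apply, indicator_apply]
      split_ifs
      · rw [jointKernel, ← weight_mul_betaPDFReal m T p s t hx, mul_assoc]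
      · simp
    simp_rw [h]
    rw [integral_const_mul, integral_indicator_betaPDFReal_comp ha hb hx,
      indicator_of_mem (show x ∈ Ioi ξ from hx)]
    field_simp

/-- The price formula under a single crossing, at a fixed value `ξ` of the claims process. -/
theorem setIntegral_arrowDebreu_mul_payoff (hm : 0 < m) (hp : Measurable p) (hp0 : ∀ x, 0 ≤ p x)
    (hpint : Integrable fun x ↦ x * p x) {s t : ℝ≥0} (hst : s < t) (htT : t < T) {ξ : ℝ}
    (hξ : 0 ≤ ξ) (hW : weightLIntegral m T p s ξ ≠ ∞) {K ystar : ℝ}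
    (hcrit : IsCriticalValue m T p P t K ystar)
    (hcross : MonotoneOn (reserve m T p P t) (reserveDomain m T p t) ∨
      IsSingleCrossing m T p P t K ystar) :
    ∫ y in Ioi (0 : ℝ), arrowDebreu m T p P s t ξ y * max (reserve m T p P t y - K) 0 =
      P s t * ∫ x in Ioi ystar, condDensity m T p s ξ x * (x * P t T - K) *
        complBeta (m * ((t : ℝ) - s)) (m * ((T : ℝ) - t)) ((ystar - ξ) / (x - ξ)) := by
  set φ : ℝ → ℝ := fun x ↦ x * P t T - K with hφ
  have hφm : Measurable φ := by fun_prop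
  have hWs := (integrableOn_weight_iff (m := m) (T := T) hp hp0 s hξ).2 hW
  have hint := integrableOn_weight_mul_affine hm hp hp0 hpint s hξ hWs (P t T) K
  set H : ℝ × ℝ → ℝ := (Prod.fst ⁻¹' Ioi ystar).indicator
    (fun q ↦ jointKernel m T p s t ξ q * φ q.2) with hH
  have hHint : Integrable H (volume.prod volume) :=
    (integrable_jointKernel_mul hm hp hp0 hst htT hξ hφm hint).indicator
      (measurable_fst measurableSet_Ioi)
  have hleft : ∫ y in Ioi (0 : ℝ), arrowDebreu m T p P s t ξ y *
      max (reserve m T p P t y - K) 0 =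
        ∫ y, P s t / weightIntegral m T p s ξ * ∫ x, H (y, x) := by
    rw [← integral_indicator measurableSet_Ioi]
    refine integral_congr_ae ?_
    filter_upwards [ae_weightLIntegral_lt_top hm hp hp0 hst htT hξ hW,
      Measure.ae_ne volume ystar] with y hy hne
    rcases le_or_gt y ξ with hyξ | hyξ
    · have h1 : ∀ x, H (y, x) = 0 := by
        intro x
        exact indicator_apply_eq_zero.2 fun _ ↦ by simp [jointKernel_of_le s t hyξ]
      rw [indicator_apply, arrowDebreu_of_le P s t hyξ]
      simp [h1]
    · have hy0 : 0 < y := hξ.trans_lt hyξ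
      have hWt := (integrableOn_weight_iff (m := m) (T := T) hp hp0 t hy0.le).2 (hy hyξ).ne
      have hpay := weightIntegral_mul_payoff (P := P) hm hp hp0 hpint hcrit hcross hy0.le hne hWt
      have h1 : ∫ x, H (y, x) = (y - ξ) ^ (m * ((t : ℝ) - s) - 1) /
          beta (m * ((t : ℝ) - s)) (m * ((T : ℝ) - t)) *
            (Ioi ystar).indicator (criticalIntegral m T p P t K) y := by
        by_cases hys : ystar < y
        · rw [indicator_of_mem (show y ∈ Ioi ystar from hys), criticalIntegral_eq_setIntegral,
            ← integral_const_mul, ← integral_indicator measurableSet_Ioi]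
          congr 1
          ext x
          rw [hH, indicator_of_mem (show (y, x) ∈ Prod.fst ⁻¹' Ioi ystar from hys),
            jointKernel_of_lt s t hyξ, indicator_apply, indicator_apply]
          split_ifs
          · simp only [hφ, mul_assoc]
          · simp
        · have h2 : ∀ x, H (y, x) = 0 := fun x ↦
            indicator_of_notMem (show (y, x) ∉ Prod.fst ⁻¹' Ioi ystar from hys) _
          rw [indicator_of_notMem (show y ∉ Ioi ystar from hys)]
          simp [h2]
      rw [h1, ← hpay, indicator_of_mem (show y ∈ Ioi (0 : ℝ) from hy0), arrowDebreu,
        indicator_of_mem (show y ∈ Ioi ξ from hyξ)]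
      ring
  rw [hleft, integral_const_mul, integral_integral_swap (f := fun y x ↦ H (y, x)) hHint]
  have hright : ∀ x, ∫ y, H (y, x) = (Ioi ystar).indicator (fun x ↦
      (Ioi ξ).indicator (weight m T p s ξ) x * φ x *
        complBeta (m * ((t : ℝ) - s)) (m * ((T : ℝ) - t)) ((ystar - ξ) / (x - ξ))) x := by
    intro x
    have h1 : ∀ y, H (y, x) =
        (Ioi ystar).indicator (fun y ↦ jointKernel m T p s t ξ (y, x)) y * φ x := by
      intro y
      by_cases hy : ystar < y
      · rw [hH, indicator_of_mem (show (y, x) ∈ Prod.fst ⁻¹' Ioi ystar from hy),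
          indicator_of_mem (show y ∈ Ioi ystar from hy)]
      · rw [hH, indicator_of_notMem (show (y, x) ∉ Prod.fst ⁻¹' Ioi ystar from hy),
          indicator_of_notMem (show y ∉ Ioi ystar from hy), zero_mul]
    simp_rw [h1]
    rw [integral_mul_const, integral_indicator_jointKernel hm hst htT]
    simp only [indicator_apply, mem_Ioi]
    by_cases hx : ξ < x
    · by_cases hxs : ystar < x
      · simp only [hx, hxs, if_true]
        ring
      · have hxξ : 0 < x - ξ := sub_pos.2 hx
        rw [complBeta_of_one_le ((one_le_div hxξ).2 (by linarith [not_lt.1 hxs]))]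
        simp
    · simp [hx]
  simp_rw [hright]
  rw [integral_indicator measurableSet_Ioi, div_mul_eq_mul_div, mul_div_assoc]
  congr 1
  rw [div_eq_mul_inv, ← integral_mul_const]
  congr 1
  ext x
  simp only [condDensity, indicator_apply]
  split_ifs
  · ring
  · simp

end Fubini

section Claims

variable {Ω : Type*} [MeasurableSpace Ω] {Q : Measure Ω} {m : ℝ} {T : ℝ≥0}
  {X : Ω → ℝ} {p : ℝ → ℝ} {β : Set.Iic T → Ω → ℝ} {P : ℝ≥0 → ℝ≥0 → ℝ}

theorem integrable_mul_density (hX : Measurable X) (hXint : Integrable X Q) (hp : Measurable p)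
    (hp0 : ∀ x, 0 ≤ p x)
    (hXp : Q.map X = (volume : Measure ℝ).withDensity (fun x ↦ ENNReal.ofReal (p x))) :
    Integrable fun x ↦ x * p x := by
  have h : Integrable (fun x : ℝ ↦ x) (Q.map X) :=
    (integrable_map_measure (by fun_prop) hX.aemeasurable).2 hXint
  rw [hXp, integrable_withDensity_iff (by fun_prop) (.of_forall fun _ ↦ ENNReal.ofReal_lt_top)] at h
  simpa [ENNReal.toReal_ofReal (hp0 _)] using h

theorem measurable_reserve (hp : Measurable p) (t : ℝ≥0) : Measurable (reserve m T p P t) := by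
  have h1 := measurable_weightIntegral (m := m) (T := T) hp t
  have h2 : Measurable fun y ↦
      ∫ x in Ioi y, p x * x ^ (2 - m * T) * (x - y) ^ (m * ((T : ℝ) - t) - 1) :=
    measurable_setIntegral_Ioi
      (F := fun q ↦ p q.2 * q.2 ^ (2 - m * T) * (q.2 - q.1) ^ (m * ((T : ℝ) - t) - 1))
      (by fun_prop)
  exact (h2.div h1).const_mul _

variable [IsProbabilityMeasure Q]

theorem integrable_reserve (hm : 0 < m) (hX : Measurable X) (hXpos : ∀ᵐ ω ∂Q, 0 < X ω)
    (hXint : Integrable X Q) (hp : Measurable p) (hp0 : ∀ x, 0 ≤ p x)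
    (hXp : Q.map X = (volume : Measure ℝ).withDensity (fun x ↦ ENNReal.ofReal (p x)))
    (hβ : IsGammaBridge m T β Q) (hindep : IndepFun X (fun ω (t : Set.Iic T) ↦ β t ω) Q)
    {t : Set.Iic T} (htT : (t : ℝ≥0) < T) :
    Integrable (fun ω ↦ reserve m T p P t (claimsProcess X β t ω)) Q := by
  have hξ := measurable_claimsProcess hX hβ t
  have hpint := integrable_mul_density hX hXint hp hp0 hXp
  have hratio : Integrable (fun ω ↦ (∫ x in Ioi (claimsProcess X β t ω),
      x * weight m T p t (claimsProcess X β t ω) x) /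
        weightIntegral m T p t (claimsProcess X β t ω)) Q := by
    have hnum : Measurable fun y ↦ ∫ x in Ioi y, x * weight m T p t y x :=
      measurable_setIntegral_Ioi (F := fun q ↦ q.2 * weight m T p t q.1 q.2)
        (measurable_snd.mul (measurable_weight hp t))
    have hden := measurable_weightIntegral (m := m) (T := T) hp t
    refine ⟨((hnum.div hden).comp hξ).aestronglyMeasurable, ?_⟩
    have hlt : ∫⁻ ω, ENNReal.ofReal (X ω) ∂Q < ∞ :=
      lt_of_le_of_lt (lintegral_mono fun ω ↦ Real.ofReal_le_enorm (X ω)) hXint.2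
    rw [lintegral_claimsProcess_terminal hm hX hXpos hp hp0 hXp hβ hindep htT
      (g := fun q ↦ ENNReal.ofReal q.2) (by fun_prop)] at hlt
    rw [hasFiniteIntegral_iff_enorm]
    refine lt_of_eq_of_lt (lintegral_congr_ae ?_) hlt
    filter_upwards [ae_weightLIntegral_claimsProcess hm hX hXpos hp hp0 hXp hβ hindep htT] with ω hω
    obtain ⟨hω0, hW0, hW⟩ := hω
    set y := claimsProcess X β t ω
    have hWt := (integrableOn_weight_iff (m := m) (T := T) hp hp0 t hω0).2 hW
    have hpos : 0 < weightIntegral m T p t y := by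
      rw [weightIntegral_eq_toReal hp hp0 t hω0]
      exact ENNReal.toReal_pos hW0 hW
    have hnn : 0 ≤ᵐ[volume.restrict (Ioi y)] fun x ↦ x * weight m T p t y x := by
      filter_upwards [self_mem_ae_restrict measurableSet_Ioi] with x hx
      exact mul_nonneg (hω0.trans (le_of_lt hx)) (weight_nonneg hp0 t hω0 hx)
    rw [Real.enorm_of_nonneg (div_nonneg (integral_nonneg_of_ae hnn) hpos.le),
      ENNReal.ofReal_div_of_pos hpos, ofReal_integral_eq_lintegral_ofReal
        (integrableOn_mul_weight hm hp hp0 hpint t hω0 hWt) hnn,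
      weightIntegral_eq_toReal hp hp0 t hω0, ENNReal.ofReal_toReal hW]
    congr 1
    refine setLIntegral_congr_fun measurableSet_Ioi fun x hx ↦ ?_
    rw [mul_comm, ENNReal.ofReal_mul (weight_nonneg hp0 t hω0 hx)]
  refine (hratio.const_mul (P t T)).congr ?_
  filter_upwards [ae_weightLIntegral_claimsProcess hm hX hXpos hp hp0 hXp hβ hindep htT] with ω hω
  rw [reserve, setIntegral_reserve_numerator _ hω.1]

theorem optionPrice_ae_eq (hm : 0 < m) (hX : Measurable X) (hXpos : ∀ᵐ ω ∂Q, 0 < X ω)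
    (hp : Measurable p) (hp0 : ∀ x, 0 ≤ p x)
    (hXp : Q.map X = (volume : Measure ℝ).withDensity (fun x ↦ ENNReal.ofReal (p x)))
    (hβ : IsGammaBridge m T β Q) (hindep : IndepFun X (fun ω (t : Set.Iic T) ↦ β t ω) Q)
    {s t : Set.Iic T} (hst : s < t) (htT : (t : ℝ≥0) < T) (hP : 0 < P s t) {K : ℝ}
    (hint : Integrable (fun ω ↦ max (reserve m T p P t (claimsProcess X β t ω) - K) 0) Q) :
    optionPrice Q m T p P (claimsProcess X β) s t K =ᵐ[Q] fun ω ↦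
      ∫ y in Ioi (0 : ℝ), arrowDebreu m T p P s t (claimsProcess X β s ω) y *
        max (reserve m T p P t y - K) 0 := by
  have hsT : (s : ℝ≥0) < T := lt_trans (show (s : ℝ≥0) < t from hst) htT
  have hξs := measurable_claimsProcess hX hβ s
  have hξt := measurable_claimsProcess hX hβ t
  have hR := measurable_reserve (m := m) (T := T) (P := P) hp t
  have hpay : Measurable fun y ↦ max (reserve m T p P t y - K) 0 := by fun_prop
  have hcond := condExp_ae_eq_integral_condDistrib hξs hξt.aemeasurable hpay.stronglyMeasurable hint
  have hAD := isArrowDebreuPrice_arrowDebreu hm (P := P) hX hXpos hp hp0 hXp hβ hindep hst htT hP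
  filter_upwards [hcond, hAD.density, hAD.nonneg,
    ae_weightLIntegral_claimsProcess hm hX hXpos hp hp0 hXp hβ hindep hsT] with ω h1 h2 h3 h4
  have hAm : Measurable fun y ↦ arrowDebreu m T p P s t (claimsProcess X β s ω) y :=
    (measurable_arrowDebreu hp P s t).comp measurable_prodMk_right
  have h5 : P s t * ∫ y, max (reserve m T p P t y - K) 0
      ∂condDistrib (claimsProcess X β t) (claimsProcess X β s) Q (claimsProcess X β s ω) =
      ∫ y, max (reserve m T p P t y - K) 0 ∂(ENNReal.ofReal (P s t) •
        condDistrib (claimsProcess X β t) (claimsProcess X β s) Q (claimsProcess X β s ω)) := by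
    rw [integral_smul_measure, ENNReal.toReal_ofReal hP.le, smul_eq_mul]
  rw [optionPrice, h1, h5, h2, integral_withDensity_eq_integral_toReal_smul (by fun_prop)
    (.of_forall fun _ ↦ ENNReal.ofReal_lt_top), ← integral_indicator measurableSet_Ioi]
  congr 1
  ext y
  rw [ENNReal.toReal_ofReal (h3 y), smul_eq_mul, indicator_apply]
  split_ifs with hy
  · rfl
  · rw [arrowDebreu_of_le P s t ((not_lt.1 hy).trans h4.1), zero_mul]

end Claims

theorem proposition7 {Ω : Type*} [MeasurableSpace Ω] (Q : Measure Ω) [IsProbabilityMeasure Q]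
    (m : ℝ) (hm : 0 < m) (T : ℝ≥0)
    (P : ℝ≥0 → ℝ≥0 → ℝ) (hP : ∀ u v, u ≤ v → 0 < P u v)
    (X : Ω → ℝ) (hX : Measurable X) (hXpos : ∀ᵐ ω ∂Q, 0 < X ω) (hXint : Integrable X Q)
    (p : ℝ → ℝ) (hp : Measurable p) (hp0 : ∀ x, 0 ≤ p x)
    (hXp : Q.map X = (volume : Measure ℝ).withDensity (fun x ↦ ENNReal.ofReal (p x)))
    (β : Set.Iic T → Ω → ℝ) (hβ : IsGammaBridge m T β Q)
    (hindep : IndepFun X (fun ω (t : Set.Iic T) ↦ β t ω) Q)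
    (s t : Set.Iic T) (hst : s < t) (htT : (t : ℝ≥0) < T) :
    IsArrowDebreuPrice Q (claimsProcess X β s) (claimsProcess X β t) (P s t)
        (fun y ω ↦ arrowDebreu m T p P s t (claimsProcess X β s ω) y) ∧
      ∀ K : ℝ,
        Integrable (fun ω ↦ max (reserve m T p P t (claimsProcess X β t ω) - K) 0) Q ∧
        (optionPrice Q m T p P (claimsProcess X β) s t K =ᵐ[Q] fun ω ↦
          ∫ y in Ioi (0 : ℝ), arrowDebreu m T p P s t (claimsProcess X β s ω) y *
            max (reserve m T p P t y - K) 0) ∧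
        ∀ ystar : ℝ, IsCriticalValue m T p P t K ystar →
          (MonotoneOn (reserve m T p P t) (reserveDomain m T p t) ∨
            IsSingleCrossing m T p P t K ystar) →
          optionPrice Q m T p P (claimsProcess X β) s t K =ᵐ[Q] fun ω ↦
            P s t * ∫ x in Ioi ystar,
              condDensity m T p s (claimsProcess X β s ω) x * (x * P t T - K) *
                complBeta (m * ((t : ℝ) - s)) (m * ((T : ℝ) - t))
                  ((ystar - claimsProcess X β s ω) / (x - claimsProcess X β s ω)) := by
  have hst' : (s : ℝ≥0) < t := hst
  have hsT : (s : ℝ≥0) < T := hst'.trans htT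
  have hPst : 0 < P s t := hP _ _ hst'.le
  have hpint := integrable_mul_density hX hXint hp hp0 hXp
  refine ⟨isArrowDebreuPrice_arrowDebreu hm hX hXpos hp hp0 hXp hβ hindep hst htT hPst,
    fun K ↦ ?_⟩
  have hint : Integrable (fun ω ↦ max (reserve m T p P t (claimsProcess X β t ω) - K) 0) Q :=
    ((integrable_reserve hm hX hXpos hXint hp hp0 hXp hβ hindep htT).sub
      (integrable_const K)).pos_part
  have hprice := optionPrice_ae_eq hm hX hXpos hp hp0 hXp hβ hindep hst htT hPst hint
  refine ⟨hint, hprice, fun ystar hcrit hcross ↦ ?_⟩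
  filter_upwards [hprice, ae_weightLIntegral_claimsProcess hm hX hXpos hp hp0 hXp hβ hindep hsT]
    with ω h1 h2
  rw [h1, setIntegral_arrowDebreu_mul_payoff hm hp hp0 hpint hst' htT h2.1 h2.2.2 hcrit hcross]
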